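/- Let $q:\mathbb{R}\to\mathbb{R}$ be integrable, $q\in L^1(\mathbb{R})$, with $q\ge 0$ almost everywhere. Then the eigenvalues (counted with multiplicity) of $$-u''(x)+\left[x^2+q(x)\right]u(x)=\lambda u(x),\qquad x\in\mathbb{R},\quad u\in L^2(\mathbb{R}),$$ can be listed as a non-decreasing sequence $\lambda_0\le\lambda_1\le\lambda_2\le\cdots$, where a solution $u$ is understood to be a differentiable function whose derivative is locally absolutely continuous and which satisfies the equation almost everywhere. Let $\lambda_k^0=2k+1$ $(k=0,1,2,\dots)$ be the eigenvalues in the case $q=0$. Then, for every $n=0,1,2,\dots$, $$\sum_{k=0}^{n}\left[\lambda_k-\lambda_k^0-\frac{1}{\pi\sqrt{\lambda_k^0}}\int_{\mathbb{R}}q(x)\,dx\right]\le\frac{\chi_n}{\pi}\int_{\mathbb{R}}q(x)\,dx,$$ where $$\chi_n=\begin{cases}\displaystyle\frac{2n+3}{n+1}\,\frac{\Gamma\left(\frac n2+1\right)}{\Gamma\left(\frac{n+1}2\right)}-\sum_{k=0}^n\frac1{\sqrt{\lambda_k^0}},& n\text{ odd},\\[2ex]\displaystyle(n+1)\,\frac{\Gamma\left(\frac{n+1}2\right)}{\Gamma\left(\frac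 n2+1\right)}-\sum_{k=0}^n\frac1{\sqrt{\lambda_k^0}},& n\text{ even}.\end{cases}$$ Furthermore, $\chi_n=-Z_0(1/2)+O(1/\sqrt n)$ as $n\to\infty$, where $Z_0(s)=(1-2^{-s})\zeta(s)$ and $\zeta$ is the Riemann zeta function. -/

import Mathlib

open MeasureTheory Filter

noncomputable section

namespace PerturbedOscillator

/-- `u` is a (real) square-integrable solution of `-u'' + (x² + q) u = μ u` on the line:
`u` is differentiable, `u'` is absolutely continuous on every compact interval (so that `u''` exists
almost everywhere), the equation holds almost everywhere, and `u ∈ L²(ℝ)`. The zero function is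
included. This is the usual sense of the equation when `q` is merely locally integrable. -/
structure IsL2Solution (q : ℝ → ℝ) (μ : ℝ) (u : ℝ → ℝ) : Prop where
  differentiable : Differentiable ℝ u
  absolutelyContinuous_deriv : ∀ a b : ℝ, AbsolutelyContinuousOnInterval (deriv u) a b
  equation : ∀ᵐ x : ℝ, -deriv (deriv u) x + (x ^ 2 + q x) * u x = μ * u x
  memLp : MemLp u 2 volume

theorem ae_differentiableAt_of_ac {f : ℝ → ℝ}
    (hf : ∀ a b : ℝ, AbsolutelyContinuousOnInterval f a b) :
    ∀ᵐ x : ℝ, DifferentiableAt ℝ f x := by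
  have h : ∀ n : ℕ, ∀ᵐ x : ℝ, x ∈ Set.uIcc (-(n : ℝ)) n → DifferentiableAt ℝ f x :=
    fun n => (hf _ _).ae_differentiableAt
  filter_upwards [ae_all_iff.2 h] with x hx
  obtain ⟨n, hn⟩ := exists_nat_ge |x|
  refine hx n ?_
  rw [Set.uIcc_of_le (by linarith [abs_nonneg x])]
  exact abs_le.1 hn

/-- The eigenspace of `-d²/dx² + x² + q` on `L²(ℝ)` for `μ`. Its elements are continuous functions,
so that no two of them agree almost everywhere. -/
def eigenspace (q : ℝ → ℝ) (μ : ℝ) : Submodule ℝ (ℝ → ℝ) where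
  carrier := {u | IsL2Solution q μ u}
  zero_mem' := by
    have h0 : deriv (0 : ℝ → ℝ) = 0 := by ext x; simp
    refine ⟨differentiable_const 0, fun a b => ?_, ?_, MemLp.zero⟩
    · rw [h0]
      exact (contDiff_const (c := (0 : ℝ))).contDiffOn.absolutelyContinuousOnInterval
    · rw [h0, h0]; simp
  add_mem' := by
    intro u v hu hv
    have hd : deriv (u + v) = deriv u + deriv v := by
      ext x; exact deriv_add (hu.differentiable x) (hv.differentiable x)
    refine ⟨hu.differentiable.add hv.differentiable, fun a b => ?_, ?_, hu.memLp.add hv.memLp⟩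
    · rw [hd]
      exact (hu.absolutelyContinuous_deriv a b).add (hv.absolutelyContinuous_deriv a b)
    · filter_upwards [hu.equation, hv.equation,
        ae_differentiableAt_of_ac hu.absolutelyContinuous_deriv,
        ae_differentiableAt_of_ac hv.absolutelyContinuous_deriv] with x h1 h2 h3 h4
      rw [hd, deriv_add h3 h4]
      simp only [Pi.add_apply]
      linarith
  smul_mem' := by
    intro c u hu
    have hd : deriv (c • u) = fun x => c * deriv u x := by
      ext x; simpa using deriv_const_smul c (hu.differentiable x)
    refine ⟨hu.differentiable.const_smul c, fun a b => ?_, ?_, hu.memLp.const_smul c⟩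
    · rw [hd]
      exact (hu.absolutelyContinuous_deriv a b).const_mul c
    · filter_upwards [hu.equation,
        ae_differentiableAt_of_ac hu.absolutelyContinuous_deriv] with x h1 h3
      rw [hd, deriv_const_mul c h3]
      simp only [Pi.smul_apply, smul_eq_mul]
      linear_combination c * h1

/-- `lam 0 ≤ lam 1 ≤ ⋯` lists all eigenvalues of `-u'' + (x² + q) u = λ u`, each repeated
according to its multiplicity: every real `μ` occurs in the list exactly
`dim (eigenspace q μ)` times (in particular not at all if it is not an eigenvalue). -/
structure IsEigenvalueSequence (q : ℝ → ℝ) (lam : ℕ → ℝ) : Prop where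
  monotone : Monotone lam
  multiplicity : ∀ μ : ℝ, Module.rank ℝ (eigenspace q μ) = Cardinal.mk {k : ℕ // lam k = μ}

/-- The eigenvalues `2k + 1` of the unperturbed oscillator. -/
def harmonicEigenvalue (k : ℕ) : ℝ := 2 * k + 1

def chi (n : ℕ) : ℝ :=
  (if Odd n then
      (2 * n + 3) / (n + 1) * (Real.Gamma (n / 2 + 1) / Real.Gamma ((n + 1) / 2))
    else
      (n + 1) * (Real.Gamma ((n + 1) / 2) / Real.Gamma (n / 2 + 1)))
    - ∑ k ∈ Finset.range (n + 1), 1 / √(harmonicEigenvalue k)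

/-- The spectral zeta function `(1 - 2^(-s)) ζ(s)` of the unperturbed oscillator. -/
def spectralZeta (s : ℂ) : ℂ := (1 - 2 ^ (-s)) * riemannZeta s

end PerturbedOscillator

end

/-!
Let `H = -d²/dx² + x²`, with the Hermite functions `h_k` as eigenfunctions. The operator `H + q`,
`q ≥ 0` integrable, need not be defined on nice functions, but its form is: writing a function of
the form domain as `u = H^(-1/2) b`, the equation `H u + q u = μ u` becomes `T b = μ H⁻¹ b` in
`ℓ²`, where `T = 1 + H^(-1/2) q H^(-1/2)` is bounded and invertible and `H^(-1/2)` is compact. Such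
a pencil has an eigenbasis, its solutions are exactly the classical square-integrable solutions
(these are bounded, as `u²` is convex near infinity, and weak solutions are classical), and
comparing traces on the span of `h_0, …, h_n` (Ky Fan) gives `∑ (λ_k - λ_k⁰) ≤ ∫ q ∑ h_k²`. It
remains to bound `C_n = ∑_{k ≤ n} h_k²`. By Christoffel–Darboux its derivative is a negative
multiple of `h_n h_{n+1}`, which changes sign, but `C_n + C_{n+1}` has derivative `-2x h_{n+1}²` and
so is largest at `x = 0`; `2 C_n ≤ C_n + C_{n+1}` is thus bounded by a quotient of Gamma functions,
whose asymptotics give the last claim.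
-/

noncomputable section

namespace PerturbedOscillator

open scoped Real Topology

/-! ### Hermite functions -/

/-- The coefficient `√(2k)` in the ladder relations `h_k' = √(2k) h_{k-1} - x h_k` and
`h_k' = x h_k - √(2(k+1)) h_{k+1}` of the Hermite functions. -/
def ladder (k : ℕ) : ℝ := √(2 * k)

theorem ladder_sq (k : ℕ) : ladder k ^ 2 = 2 * k := Real.sq_sqrt (by positivity)

@[simp]
theorem ladder_zero : ladder 0 = 0 := by simp [ladder]

theorem ladder_succ_sq (k : ℕ) : ladder (k + 1) ^ 2 = 2 * (k + 1) := by
  rw [ladder_sq, Nat.cast_add_one]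

theorem ladder_succ_pos (k : ℕ) : 0 < ladder (k + 1) := by
  unfold ladder; positivity

/-- The `L²`-normalized Hermite functions, defined by their three-term recurrence. For `k = 0` the
second term of the recurrence vanishes, so the truncated index `0 - 1 = 0` is harmless there and in
all the relations below. -/
def hermiteFn : ℕ → ℝ → ℝ
  | 0, x => √(1 / √π) * Real.exp (-x ^ 2 / 2)
  | k + 1, x => (2 * x * hermiteFn k x - ladder k * hermiteFn (k - 1) x) / ladder (k + 1)

theorem hermiteFn_zero (x : ℝ) : hermiteFn 0 x = √(1 / √π) * Real.exp (-x ^ 2 / 2) := by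
  rw [hermiteFn]

theorem two_mul_mul_hermiteFn (k : ℕ) (x : ℝ) :
    2 * x * hermiteFn k x
      = ladder (k + 1) * hermiteFn (k + 1) x + ladder k * hermiteFn (k - 1) x := by
  rw [hermiteFn, mul_div_cancel₀ _ (ladder_succ_pos k).ne', sub_add_cancel]

theorem hasDerivAt_hermiteFn_zero (x : ℝ) :
    HasDerivAt (hermiteFn 0) (-(x * hermiteFn 0 x)) x := by
  have h : HasDerivAt (fun x : ℝ => -x ^ 2 / 2) (-x) x :=
    ((hasDerivAt_pow 2 x).fun_neg.div_const 2).congr_deriv (by push_cast; ring)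
  rw [funext hermiteFn_zero]
  exact (h.exp.const_mul √(1 / √π)).congr_deriv (by ring)

theorem hasDerivAt_hermiteFn (k : ℕ) (x : ℝ) :
    HasDerivAt (hermiteFn k) (ladder k * hermiteFn (k - 1) x - x * hermiteFn k x) x := by
  induction k using Nat.strong_induction_on generalizing x with
  | _ k ih =>
    cases k with
    | zero => simpa using hasDerivAt_hermiteFn_zero x
    | succ n =>
      have hprev : HasDerivAt (fun x => ladder n * hermiteFn (n - 1) x)
          (ladder n * (x * hermiteFn (n - 1) x - ladder n * hermiteFn n x)) x := by
        cases n with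
        | zero => simpa using hasDerivAt_const x (0 : ℝ)
        | succ m =>
          refine ((ih m (by lia) x).congr_deriv ?_).const_mul _
          simp only [Nat.add_sub_cancel]
          linear_combination -(two_mul_mul_hermiteFn m x)
      have hrec : hermiteFn (n + 1) = fun x =>
          (2 * x * hermiteFn n x - ladder n * hermiteFn (n - 1) x) / ladder (n + 1) :=
        funext fun y => by rw [hermiteFn]
      have hpos := (ladder_succ_pos n).ne'
      rw [hrec]
      refine ((((hasDerivAt_id x).const_mul 2).mul (ih n (by lia) x)).sub hprev
        |>.div_const (ladder (n + 1))).congr_deriv ?_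
      field_simp
      simp only [id, Nat.add_sub_cancel]
      linear_combination -hermiteFn n x * ladder_succ_sq n + hermiteFn n x * ladder_sq n

theorem hasDerivAt_hermiteFn' (k : ℕ) (x : ℝ) :
    HasDerivAt (hermiteFn k) (x * hermiteFn k x - ladder (k + 1) * hermiteFn (k + 1) x) x :=
  (hasDerivAt_hermiteFn k x).congr_deriv (by linear_combination -(two_mul_mul_hermiteFn k x))

theorem deriv_hermiteFn (k : ℕ) :
    deriv (hermiteFn k) = fun x => x * hermiteFn k x - ladder (k + 1) * hermiteFn (k + 1) x :=
  funext fun x => (hasDerivAt_hermiteFn' k x).deriv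

theorem hasDerivAt_deriv_hermiteFn (k : ℕ) (x : ℝ) :
    HasDerivAt (deriv (hermiteFn k)) ((x ^ 2 - harmonicEigenvalue k) * hermiteFn k x) x := by
  rw [deriv_hermiteFn]
  refine (((hasDerivAt_id x).mul (hasDerivAt_hermiteFn' k x)).sub
    ((hasDerivAt_hermiteFn (k + 1) x).const_mul (ladder (k + 1)))).congr_deriv ?_
  simp only [id, Nat.add_sub_cancel, harmonicEigenvalue]
  linear_combination -hermiteFn k x * ladder_succ_sq k

theorem differentiable_hermiteFn (k : ℕ) : Differentiable ℝ (hermiteFn k) :=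
  fun x => (hasDerivAt_hermiteFn k x).differentiableAt

@[fun_prop]
theorem continuous_hermiteFn (k : ℕ) : Continuous (hermiteFn k) :=
  (differentiable_hermiteFn k).continuous

theorem differentiable_deriv_hermiteFn (k : ℕ) : Differentiable ℝ (deriv (hermiteFn k)) :=
  fun x => (hasDerivAt_deriv_hermiteFn k x).differentiableAt

theorem deriv_deriv_hermiteFn (k : ℕ) : deriv (deriv (hermiteFn k)) =
    fun x => (x ^ 2 - harmonicEigenvalue k) * hermiteFn k x :=
  funext fun x => (hasDerivAt_deriv_hermiteFn k x).deriv

theorem add_two_mul_hermiteFn_add_two_zero_sq (n : ℕ) :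
    (n + 2) * hermiteFn (n + 2) 0 ^ 2 = (n + 1) * hermiteFn n 0 ^ 2 := by
  have hrec : ladder (n + 2) * hermiteFn (n + 2) 0 = -(ladder (n + 1) * hermiteFn n 0) := by
    linear_combination (norm := (simp only [Nat.add_sub_cancel]; ring))
      -(two_mul_mul_hermiteFn (n + 1) 0)
  have hsq := congrArg (· ^ 2) hrec
  simp only [neg_sq, mul_pow, ladder_sq] at hsq
  push_cast at hsq
  linarith

theorem hermiteFn_odd_apply_zero (m : ℕ) : hermiteFn (2 * m + 1) 0 = 0 := by
  induction m with
  | zero => simp [hermiteFn]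
  | succ m ih =>
    have h := add_two_mul_hermiteFn_add_two_zero_sq (2 * m + 1)
    rw [ih, zero_pow two_ne_zero, mul_zero] at h
    exact pow_eq_zero_iff two_ne_zero |>.1 ((mul_eq_zero.1 h).resolve_left (by positivity))

theorem hermiteFn_even_apply_zero_sq (m : ℕ) :
    hermiteFn (2 * m) 0 ^ 2 = Real.Gamma (m + 1 / 2) / (π * Real.Gamma (m + 1)) := by
  induction m with
  | zero =>
    simp only [mul_zero, hermiteFn_zero, mul_pow, Real.sq_sqrt (by positivity : 0 ≤ 1 / √π),
      Nat.cast_zero, zero_add, Real.Gamma_one_half_eq, Real.Gamma_one]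
    field_simp
    simp [Real.sq_sqrt Real.pi_pos.le]
  | succ m ih =>
    have h := add_two_mul_hermiteFn_add_two_zero_sq (2 * m)
    have hhalf : Real.Gamma ((m + 1 : ℕ) + 1 / 2) = (m + 1 / 2) * Real.Gamma (m + 1 / 2) := by
      rw [← Real.Gamma_add_one (by positivity)]; push_cast; ring_nf
    have hone : Real.Gamma ((m + 1 : ℕ) + 1) = (m + 1) * Real.Gamma (m + 1) := by
      rw [← Real.Gamma_add_one (by positivity)]; push_cast; rfl
    have hpos := Real.Gamma_pos_of_pos (show (0 : ℝ) < m + 1 by positivity)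
    rw [ih] at h
    rw [hhalf, hone, mul_add_one]
    push_cast at h
    field_simp at h ⊢
    linear_combination h

/-! ### The Christoffel–Darboux kernel on the diagonal -/

/-- The diagonal `∑_{k ≤ n} h_k(x)²` of the Christoffel–Darboux kernel. -/
def christoffel (n : ℕ) (x : ℝ) : ℝ := ∑ k ∈ Finset.range (n + 1), hermiteFn k x ^ 2

theorem christoffel_succ (n : ℕ) (x : ℝ) :
    christoffel (n + 1) x = christoffel n x + hermiteFn (n + 1) x ^ 2 :=
  Finset.sum_range_succ _ _

theorem hasDerivAt_christoffel (n : ℕ) (x : ℝ) :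
    HasDerivAt (christoffel n) (-(ladder (n + 1) * hermiteFn n x * hermiteFn (n + 1) x)) x := by
  induction n with
  | zero =>
    have hrec := two_mul_mul_hermiteFn 0 x
    rw [show christoffel 0 = fun x => hermiteFn 0 x ^ 2 by ext; simp [christoffel]]
    refine ((hasDerivAt_hermiteFn_zero x).pow 2).congr_deriv ?_
    simp only [ladder_zero] at hrec
    linear_combination -hermiteFn 0 x * hrec
  | succ n ih =>
    have hrec := two_mul_mul_hermiteFn (n + 1) x
    rw [funext (christoffel_succ n)]
    refine (ih.add ((hasDerivAt_hermiteFn (n + 1) x).pow 2)).congr_deriv ?_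
    simp only [Nat.add_sub_cancel] at hrec ⊢
    linear_combination -hermiteFn (n + 1) x * hrec

theorem hasDerivAt_christoffel_add_succ (n : ℕ) (x : ℝ) :
    HasDerivAt (fun x => christoffel n x + christoffel (n + 1) x)
      (-(2 * x * hermiteFn (n + 1) x ^ 2)) x := by
  have hrec := two_mul_mul_hermiteFn (n + 1) x
  refine ((hasDerivAt_christoffel n x).add (hasDerivAt_christoffel (n + 1) x)).congr_deriv ?_
  simp only [Nat.add_sub_cancel] at hrec
  linear_combination hermiteFn (n + 1) x * hrec

theorem apply_le_apply_zero_of_mul_deriv_nonpos {f f' : ℝ → ℝ} (hf : ∀ x, HasDerivAt f (f' x) x)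
    (hf' : ∀ x, x * f' x ≤ 0) (x : ℝ) : f x ≤ f 0 := by
  have hd : Differentiable ℝ f := fun y => (hf y).differentiableAt
  rcases le_total 0 x with hx | hx
  · refine antitoneOn_of_deriv_nonpos (convex_Ici 0) hd.continuous.continuousOn hd.differentiableOn
      (fun y hy => ?_) Set.self_mem_Ici hx hx
    rw [interior_Ici] at hy
    exact (hf y).deriv ▸ nonpos_of_mul_nonpos_right (hf' y) hy
  · refine monotoneOn_of_deriv_nonneg (convex_Iic 0) hd.continuous.continuousOn hd.differentiableOn
      (fun y hy => ?_) hx Set.self_mem_Iic hx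
    rw [interior_Iic] at hy
    exact (hf y).deriv ▸ nonneg_of_mul_nonpos_right (hf' y) hy

theorem two_mul_christoffel_le (n : ℕ) (x : ℝ) :
    2 * christoffel n x ≤ christoffel n 0 + christoffel (n + 1) 0 :=
  calc 2 * christoffel n x ≤ christoffel n x + christoffel (n + 1) x := by
        rw [christoffel_succ]; linarith [sq_nonneg (hermiteFn (n + 1) x)]
    _ ≤ christoffel n 0 + christoffel (n + 1) 0 :=
        apply_le_apply_zero_of_mul_deriv_nonpos (hasDerivAt_christoffel_add_succ n)
          (fun y => by nlinarith [sq_nonneg (y * hermiteFn (n + 1) y)]) x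

theorem christoffel_add_succ_zero (n : ℕ) :
    christoffel n 0 + christoffel (n + 1) 0
      = 2 * (n + 1) * hermiteFn n 0 ^ 2 + (2 * n + 3) * hermiteFn (n + 1) 0 ^ 2 := by
  induction n with
  | zero =>
    simp only [christoffel, Finset.sum_range_succ, Finset.sum_range_zero, Nat.cast_zero,
      show hermiteFn (0 + 1) 0 = 0 from hermiteFn_odd_apply_zero 0]
    ring
  | succ n ih =>
    rw [christoffel_succ n] at ih
    rw [christoffel_succ (n + 1), christoffel_succ n]
    push_cast
    linear_combination ih - 2 * add_two_mul_hermiteFn_add_two_zero_sq n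

/-- The Gamma-function expression in `chi`. -/
def gammaTerm (n : ℕ) : ℝ :=
  if Odd n then
    (2 * n + 3) / (n + 1) * (Real.Gamma (n / 2 + 1) / Real.Gamma ((n + 1) / 2))
  else
    (n + 1) * (Real.Gamma ((n + 1) / 2) / Real.Gamma (n / 2 + 1))

theorem chi_eq (n : ℕ) :
    chi n = gammaTerm n - ∑ k ∈ Finset.range (n + 1), 1 / √(harmonicEigenvalue k) := rfl

theorem christoffel_add_succ_zero_eq_gammaTerm (n : ℕ) :
    christoffel n 0 + christoffel (n + 1) 0 = 2 * (gammaTerm n / π) := by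
  rw [christoffel_add_succ_zero]
  rcases Nat.even_or_odd' n with ⟨m, rfl | rfl⟩
  · rw [gammaTerm, if_neg (by simp), hermiteFn_odd_apply_zero, hermiteFn_even_apply_zero_sq]
    push_cast
    rw [show (2 * m + 1) / 2 = (m + 1 / 2 : ℝ) by ring, show 2 * m / 2 + 1 = (m + 1 : ℝ) by ring]
    ring
  · have hΓ : Real.Gamma ((m + 1 : ℕ) + 1) = (m + 1) * Real.Gamma (m + 1) := by
      rw [← Real.Gamma_add_one (by positivity)]; push_cast; rfl
    rw [gammaTerm, if_pos (by simp), hermiteFn_odd_apply_zero,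
      show 2 * m + 1 + 1 = 2 * (m + 1) by ring, hermiteFn_even_apply_zero_sq, hΓ]
    push_cast
    rw [show (2 * m + 1) / 2 + 1 = (m + 1 + 1 / 2 : ℝ) by ring,
      show (2 * m + 1 + 1) / 2 = (m + 1 : ℝ) by ring]
    field_simp
    ring

theorem christoffel_le (n : ℕ) (x : ℝ) : christoffel n x ≤ gammaTerm n / π := by
  linarith [two_mul_christoffel_le n x, christoffel_add_succ_zero_eq_gammaTerm n]

/-! ### Asymptotics of the Gamma term -/

/-- The quotient `Γ(x + 1/2) / Γ(x)`, whose square lies between `x² / (x + 1/2)` and `x`. -/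
def gammaRatio (x : ℝ) : ℝ := Real.Gamma (x + 1 / 2) / Real.Gamma x

theorem gammaRatio_pos {x : ℝ} (hx : 0 < x) : 0 < gammaRatio x :=
  div_pos (Real.Gamma_pos_of_pos (by linarith)) (Real.Gamma_pos_of_pos hx)

-- This is log-convexity of `Γ` at the midpoint of `x` and `x + 1`.
theorem gammaRatio_sq_le {x : ℝ} (hx : 0 < x) : gammaRatio x ^ 2 ≤ x := by
  have h := Real.Gamma_mul_add_mul_le_rpow_Gamma_mul_rpow_Gamma hx (add_pos hx one_pos)
    one_half_pos one_half_pos (add_halves 1)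
  have hΓ := Real.Gamma_pos_of_pos hx
  rw [show 1 / 2 * x + 1 / 2 * (x + 1) = x + 1 / 2 by ring, ← Real.sqrt_eq_rpow,
    ← Real.sqrt_eq_rpow, ← Real.sqrt_mul hΓ.le, Real.Gamma_add_one hx.ne',
    Real.le_sqrt' (Real.Gamma_pos_of_pos (by linarith))] at h
  rw [gammaRatio, div_pow, div_le_iff₀ (by positivity)]
  linarith

theorem gammaRatio_mul_gammaRatio_add_half {x : ℝ} (hx : 0 < x) :
    gammaRatio x * gammaRatio (x + 1 / 2) = x := by
  have _ := Real.Gamma_pos_of_pos hx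
  have _ := Real.Gamma_pos_of_pos (show 0 < x + 1 / 2 by linarith)
  rw [gammaRatio, gammaRatio, add_assoc, add_halves, Real.Gamma_add_one hx.ne']
  field_simp

theorem sq_le_mul_gammaRatio_sq {x : ℝ} (hx : 0 < x) : x ^ 2 ≤ (x + 1 / 2) * gammaRatio x ^ 2 := by
  have h := gammaRatio_sq_le (show 0 < x + 1 / 2 by linarith)
  calc x ^ 2 = gammaRatio x ^ 2 * gammaRatio (x + 1 / 2) ^ 2 := by
        rw [← mul_pow, gammaRatio_mul_gammaRatio_add_half hx]
    _ ≤ (x + 1 / 2) * gammaRatio x ^ 2 := by rw [mul_comm]; gcongr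

theorem gammaTerm_eq_gammaRatio (n : ℕ) :
    gammaTerm n = if Odd n then (2 * n + 3) / (n + 1) * gammaRatio ((n + 1) / 2)
      else (n + 1) / gammaRatio ((n + 1) / 2) := by
  simp only [gammaTerm, gammaRatio]
  rw [show ((n : ℝ) + 1) / 2 + 1 / 2 = n / 2 + 1 by ring, div_div_eq_mul_div, mul_div_assoc]

theorem gammaTerm_pos (n : ℕ) : 0 < gammaTerm n := by
  have := gammaRatio_pos (show 0 < ((n : ℝ) + 1) / 2 by positivity)
  rw [gammaTerm_eq_gammaRatio]
  split_ifs <;> positivity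

theorem le_gammaTerm_sq (n : ℕ) : 2 * (n : ℝ) + 2 ≤ gammaTerm n ^ 2 := by
  have hx : 0 < ((n : ℝ) + 1) / 2 := by positivity
  have hpos := gammaRatio_pos hx
  have hle := gammaRatio_sq_le hx
  have hge := sq_le_mul_gammaRatio_sq hx
  rw [gammaTerm_eq_gammaRatio]
  split_ifs
  · rw [mul_pow, div_pow, div_mul_eq_mul_div, le_div_iff₀ (by positivity)]
    nlinarith [sq_nonneg (gammaRatio (((n : ℝ) + 1) / 2))]
  · rw [div_pow, le_div_iff₀ (by positivity)]
    nlinarith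

theorem gammaTerm_sq_le (n : ℕ) : gammaTerm n ^ 2 ≤ 2 * n + 5 := by
  have hx : 0 < ((n : ℝ) + 1) / 2 := by positivity
  have hpos := gammaRatio_pos hx
  have hle := gammaRatio_sq_le hx
  have hge := sq_le_mul_gammaRatio_sq hx
  rw [gammaTerm_eq_gammaRatio]
  split_ifs
  · rw [mul_pow, div_pow, div_mul_eq_mul_div, div_le_iff₀ (by positivity)]
    nlinarith [sq_nonneg (2 * (n : ℝ) + 3)]
  · rw [div_pow, div_le_iff₀ (by positivity)]
    nlinarith

theorem abs_gammaTerm_sub_sqrt_le {n : ℕ} (hn : 0 < n) : |gammaTerm n - √(2 * n)| ≤ 5 / √n := by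
  have hn' : (0 : ℝ) < n := Nat.cast_pos.2 hn
  have hsq : √(2 * (n : ℝ)) ^ 2 = 2 * n := Real.sq_sqrt (by positivity)
  have hle : √(2 * (n : ℝ)) ≤ gammaTerm n :=
    le_of_sq_le_sq (by linarith [le_gammaTerm_sq n]) (gammaTerm_pos n).le
  have hsqrt : √(n : ℝ) ≤ √(2 * (n : ℝ)) := Real.sqrt_le_sqrt (by linarith)
  rw [abs_of_nonneg (sub_nonneg.2 hle), le_div_iff₀ (by positivity)]
  calc (gammaTerm n - √(2 * n)) * √n ≤ (gammaTerm n - √(2 * n)) * (gammaTerm n + √(2 * n)) :=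
        mul_le_mul_of_nonneg_left (by linarith [gammaTerm_pos n]) (sub_nonneg.2 hle)
    _ ≤ 5 := by linarith [gammaTerm_sq_le n]

/-! ### Partial sums of the zeta function to the left of the line `Re s = 1` -/

theorem hasDerivAt_ofReal_cpow_of_pos (r : ℂ) {t : ℝ} (ht : 0 < t) :
    HasDerivAt (fun y : ℝ => (y : ℂ) ^ r) (r * (t : ℂ) ^ (r - 1)) t := by
  simpa using ((hasDerivAt_id (t : ℂ)).cpow_const (c := r) (Or.inl (by simpa using ht))).comp_ofReal

theorem norm_cpow_neg_sub_cpow_neg_le {s : ℂ} (hs : 0 < s.re) {a t b : ℝ} (ha : 0 < a)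
    (hat : a ≤ t) (htb : t ≤ b) :
    ‖(b : ℂ) ^ (-s) - (t : ℂ) ^ (-s)‖ ≤ ‖s‖ * a ^ (-s.re - 1) * (b - t) := by
  refine norm_image_sub_le_of_norm_deriv_le_segment' (f := fun y : ℝ => (y : ℂ) ^ (-s))
    (fun x hx => (hasDerivAt_ofReal_cpow_of_pos (-s)
      (ha.trans_le (hat.trans hx.1))).hasDerivWithinAt) (fun x hx => ?_) b ⟨htb, le_rfl⟩
  have hax := hat.trans hx.1
  rw [norm_mul, norm_neg, Complex.norm_cpow_eq_rpow_re_of_pos (ha.trans_le hax), Complex.sub_re,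
    Complex.neg_re, Complex.one_re]
  gcongr ‖s‖ * ?_
  exact Real.rpow_le_rpow_of_nonpos ha hax (by linarith)

/-- `(1 - s)` times the error `(n + 2)⁻ˢ - ∫ t⁻ˢ` over `n + 1 ≤ t ≤ n + 2` of the `n`-th step in
comparing `∑ k⁻ˢ` with `∫ t⁻ˢ`. The factor `1 - s` removes the singularity at `s = 1`. -/
def zetaStep (n : ℕ) (s : ℂ) : ℂ :=
  (1 - s) * ((n : ℂ) + 2) ^ (-s) - (((n : ℂ) + 2) ^ (1 - s) - ((n : ℂ) + 1) ^ (1 - s))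

theorem norm_zetaStep_le (n : ℕ) {s : ℂ} (hs : 0 < s.re) :
    ‖zetaStep n s‖ ≤ ‖1 - s‖ * ‖s‖ * ((n : ℝ) + 1) ^ (-s.re - 1) := by
  have hpos : (0 : ℝ) < n + 1 := by positivity
  set b : ℝ := n + 2 with hb
  -- `zetaStep n s` is the increment of this function from `n + 1` to `n + 2`.
  let f : ℝ → ℂ := fun t => (1 - s) * (b : ℂ) ^ (-s) * t - (t : ℂ) ^ (1 - s)
  have hf : ∀ t ∈ Set.Icc ((n : ℝ) + 1) b,
      HasDerivWithinAt f ((1 - s) * ((b : ℂ) ^ (-s) - (t : ℂ) ^ (-s))) (Set.Icc (n + 1) b) t := by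
    intro t ht
    have h := ((hasDerivAt_id (t : ℂ)).const_mul ((1 - s) * (b : ℂ) ^ (-s))).comp_ofReal.sub
      (hasDerivAt_ofReal_cpow_of_pos (1 - s) (hpos.trans_le ht.1))
    refine (h.congr_deriv ?_).hasDerivWithinAt
    rw [show 1 - s - 1 = -s by ring]
    ring
  have hbound : ∀ t ∈ Set.Ico ((n : ℝ) + 1) b, ‖(1 - s) * ((b : ℂ) ^ (-s) - (t : ℂ) ^ (-s))‖
      ≤ ‖1 - s‖ * (‖s‖ * ((n : ℝ) + 1) ^ (-s.re - 1)) := by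
    intro t ht
    rw [norm_mul]
    refine mul_le_mul_of_nonneg_left ?_ (norm_nonneg _)
    refine (norm_cpow_neg_sub_cpow_neg_le hs hpos ht.1 ht.2.le).trans ?_
    exact mul_le_of_le_one_right (by positivity) (by linarith [ht.1])
  have h := norm_image_sub_le_of_norm_deriv_le_segment' hf hbound b ⟨by linarith, le_rfl⟩
  calc ‖zetaStep n s‖ = ‖f b - f (n + 1)‖ := by
        congr 1; simp only [zetaStep, f, hb]; push_cast; ring
    _ ≤ _ := h
    _ = _ := by rw [hb]; ring

theorem sum_zetaStep (s : ℂ) (N : ℕ) :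
    ∑ n ∈ Finset.range N, zetaStep n s
      = (1 - s) * (∑ k ∈ Finset.range (N + 1), 1 / ((k : ℂ) + 1) ^ s - 1)
        - ((N : ℂ) + 1) ^ (1 - s) + 1 := by
  induction N with
  | zero => simp
  | succ N ih =>
    rw [Finset.sum_range_succ, ih, Finset.sum_range_succ _ (N + 1), zetaStep, Complex.cpow_neg]
    push_cast
    rw [show (N : ℂ) + 1 + 1 = N + 2 by ring]
    ring

theorem differentiable_zetaStep (n : ℕ) : Differentiable ℂ (zetaStep n) := by
  intro s
  have h₁ : (n : ℂ) + 1 ≠ 0 := by exact_mod_cast n.succ_ne_zero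
  have h₂ : (n : ℂ) + 2 ≠ 0 := by exact_mod_cast (n + 1).succ_ne_zero
  have e₁ : DifferentiableAt ℂ (fun s : ℂ => ((n : ℂ) + 2) ^ (-s)) s :=
    DifferentiableAt.const_cpow (by fun_prop) (Or.inl h₂)
  have e₂ : DifferentiableAt ℂ (fun s : ℂ => ((n : ℂ) + 2) ^ (1 - s)) s :=
    DifferentiableAt.const_cpow (by fun_prop) (Or.inl h₂)
  have e₃ : DifferentiableAt ℂ (fun s : ℂ => ((n : ℂ) + 1) ^ (1 - s)) s :=
    DifferentiableAt.const_cpow (by fun_prop) (Or.inl h₁)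
  unfold zetaStep
  fun_prop

/-- The bounded convex regions on which the series `∑ zetaStep n s` is dominated by a convergent
series; they exhaust the half-plane `0 < Re s`. -/
def zetaRegion (σ R : ℝ) : Set ℂ := {s | σ < s.re} ∩ Metric.ball 0 R

theorem isOpen_zetaRegion (σ R : ℝ) : IsOpen (zetaRegion σ R) :=
  (isOpen_lt continuous_const Complex.continuous_re).inter Metric.isOpen_ball

theorem convex_zetaRegion (σ R : ℝ) : Convex ℝ (zetaRegion σ R) :=
  (convex_halfSpace_re_gt _).inter (convex_ball _ _)

theorem norm_zetaStep_le_of_mem_zetaRegion {σ R : ℝ} (hσ : 0 < σ) (n : ℕ) {s : ℂ}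
    (hs : s ∈ zetaRegion σ R) : ‖zetaStep n s‖ ≤ (1 + R) * R * (1 / |(n : ℝ) + 1| ^ (σ + 1)) := by
  obtain ⟨hre, hnorm⟩ := hs
  rw [Set.mem_ofPred_eq] at hre
  rw [mem_ball_zero_iff] at hnorm
  have hR : 0 < R := (norm_nonneg _).trans_lt hnorm
  have hsub : ‖1 - s‖ ≤ 1 + R := (norm_sub_le _ _).trans (by rw [norm_one]; linarith)
  have hn : (1 : ℝ) ≤ n + 1 := by linarith [(Nat.cast_nonneg n : (0 : ℝ) ≤ n)]
  rw [abs_of_pos (by linarith), one_div, ← Real.rpow_neg (by linarith)]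
  refine (norm_zetaStep_le n (hσ.trans hre)).trans ?_
  gcongr
  linarith

theorem summable_zetaStep {s : ℂ} (hs : 0 < s.re) : Summable (zetaStep · s) :=
  Summable.of_norm_bounded
    (((Real.summable_one_div_nat_add_rpow 1 _).2 (lt_add_of_pos_left 1 (half_pos hs))).mul_left _)
    fun n => norm_zetaStep_le_of_mem_zetaRegion (R := ‖s‖ + 1) (half_pos hs) n
      ⟨half_lt_self hs, by simp⟩

theorem tsum_zetaStep_of_one_lt_re {s : ℂ} (hs : 1 < s.re) :
    ∑' n, zetaStep n s = (1 - s) * (riemannZeta s - 1) + 1 := by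
  refine tendsto_nhds_unique (summable_zetaStep (by linarith)).hasSum.tendsto_sum_nat ?_
  have hsum : Summable fun k : ℕ => 1 / ((k : ℂ) + 1) ^ s := by
    simpa using (summable_nat_add_iff 1).2 (Complex.summable_one_div_nat_cpow.2 hs)
  have hzeta := hsum.hasSum.tendsto_sum_nat.comp (tendsto_add_atTop_nat 1)
  rw [← zeta_eq_tsum_one_div_nat_add_one_cpow hs] at hzeta
  have hpow : Tendsto (fun N : ℕ => ((N : ℂ) + 1) ^ (1 - s)) atTop (𝓝 0) := by
    have hnorm (N : ℕ) : ‖((N : ℂ) + 1) ^ (1 - s)‖ = ((N : ℝ) + 1) ^ (-(s.re - 1)) := by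
      simpa using Complex.norm_cpow_eq_rpow_re_of_pos (x := (N : ℝ) + 1) (by positivity) (1 - s)
    rw [tendsto_zero_iff_norm_tendsto_zero]
    simp_rw [hnorm]
    exact (tendsto_rpow_neg_atTop (sub_pos.2 hs)).comp
      (tendsto_atTop_add_const_right _ 1 tendsto_natCast_atTop_atTop)
  simp_rw [sum_zetaStep]
  simpa using (((hzeta.sub_const 1).const_mul (1 - s)).sub hpow).add_const 1

-- Both sides are holomorphic in `0 < Re s` and they agree for `1 < Re s`.
theorem tsum_zetaStep {s : ℂ} (hs : 0 < s.re) : ∑' n, zetaStep n s = s - riemannZeta₁ s := by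
  set σ := min (s.re / 2) 1
  set R := ‖s‖ + 3
  have hσ : 0 < σ := lt_min (half_pos hs) one_pos
  have hsum := ((Real.summable_one_div_nat_add_rpow 1 _).2 (lt_add_of_pos_left 1 hσ)).mul_left
    ((1 + R) * R)
  have hmem : s ∈ zetaRegion σ R :=
    ⟨(min_le_left _ _).trans_lt (half_lt_self hs), by simp [R]⟩
  have htwo : (2 : ℂ) ∈ zetaRegion σ R :=
    ⟨show σ < (2 : ℂ).re from (min_le_right _ _).trans_lt (by norm_num),
      by simp [R]; linarith [norm_nonneg s]⟩
  have hdiff : DifferentiableOn ℂ (fun w => ∑' n, zetaStep n w) (zetaRegion σ R) :=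
    Complex.differentiableOn_tsum_of_summable_norm hsum
      (fun n => (differentiable_zetaStep n).differentiableOn) (isOpen_zetaRegion σ R)
      fun n w hw => norm_zetaStep_le_of_mem_zetaRegion hσ n hw
  refine AnalyticOnNhd.eqOn_of_preconnected_of_eventuallyEq (g := fun s => s - riemannZeta₁ s)
    (hdiff.analyticOnNhd (isOpen_zetaRegion σ R))
    ((by fun_prop : Differentiable ℂ fun s => s - riemannZeta₁ s).differentiableOn.analyticOnNhd
      (isOpen_zetaRegion σ R)) (convex_zetaRegion σ R).isPreconnected htwo ?_ hmem
  have hre : ∀ᶠ w : ℂ in 𝓝 2, 1 < w.re :=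
    (isOpen_lt continuous_const Complex.continuous_re).mem_nhds (by simp)
  filter_upwards [hre] with w hw
  have hne : w ≠ 1 := by rintro rfl; simp at hw
  have hsub : w - 1 ≠ 0 := sub_ne_zero.2 hne
  rw [tsum_zetaStep_of_one_lt_re hw, riemannZeta_eq_inv_sub_mul hne]
  field_simp
  ring

theorem tendsto_sum_one_div_cpow_sub {s : ℂ} (hs : 0 < s.re) (hs' : s ≠ 1) :
    Tendsto (fun N : ℕ => ∑ k ∈ Finset.range N, 1 / ((k : ℂ) + 1) ^ s - (N : ℂ) ^ (1 - s) / (1 - s))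
      atTop (𝓝 (riemannZeta s)) := by
  have hne : 1 - s ≠ 0 := sub_ne_zero.2 hs'.symm
  have hne' : s - 1 ≠ 0 := sub_ne_zero.2 hs'
  have h := (((summable_zetaStep hs).hasSum.tendsto_sum_nat.sub_const s).div_const (1 - s))
  rw [tsum_zetaStep hs] at h
  refine (tendsto_add_atTop_iff_nat 1).1 ?_
  convert h using 2 with N
  · rw [sum_zetaStep]
    push_cast
    field_simp
    ring
  · rw [riemannZeta_eq_inv_sub_mul hs']
    field_simp
    ring

/-! ### Asymptotics of `chi` -/

/-- The regularized partial sums `∑_{k ≤ N} k^{-1/2} - 2√N` of `ζ(1/2)`. -/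
def halfSum (N : ℕ) : ℝ := ∑ k ∈ Finset.range N, 1 / √((k : ℝ) + 1) - 2 * √(N : ℝ)

theorem ofReal_cpow_one_half {x : ℝ} (hx : 0 ≤ x) : (x : ℂ) ^ (1 / 2 : ℂ) = (√x : ℝ) := by
  rw [Real.sqrt_eq_rpow, Complex.ofReal_cpow hx]
  norm_num

theorem tendsto_halfSum : Tendsto (fun N => (halfSum N : ℂ)) atTop (𝓝 (riemannZeta (1 / 2))) := by
  refine (tendsto_sum_one_div_cpow_sub (s := 1 / 2) (by norm_num) (by norm_num)).congr fun N => ?_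
  have hterm (k : ℕ) : ((k : ℂ) + 1) ^ (1 / 2 : ℂ) = (√((k : ℝ) + 1) : ℝ) := by
    rw [← ofReal_cpow_one_half (by positivity)]; push_cast; rfl
  have hN : (N : ℂ) ^ (1 / 2 : ℂ) = (√(N : ℝ) : ℝ) := by
    rw [← ofReal_cpow_one_half N.cast_nonneg]; push_cast; rfl
  simp_rw [hterm, show (1 - 1 / 2 : ℂ) = 1 / 2 by norm_num, hN, halfSum]
  push_cast
  ring

theorem one_div_sqrt_add_one_le {x : ℝ} (hx : 0 ≤ x) : 1 / √(x + 1) ≤ 2 * (√(x + 1) - √x) := by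
  have hx1 : √(x + 1) ^ 2 = x + 1 := Real.sq_sqrt (by linarith)
  rw [div_le_iff₀ (by positivity)]
  nlinarith [Real.sq_sqrt hx, sq_nonneg (√(x + 1) - √x)]

theorem two_mul_sqrt_add_one_sub_sqrt_le {x : ℝ} (hx : 0 < x) :
    2 * (√(x + 1) - √x) ≤ 1 / √x := by
  have hx1 : √(x + 1) ^ 2 = x + 1 := Real.sq_sqrt (by linarith)
  rw [le_div_iff₀ (by positivity)]
  nlinarith [Real.sq_sqrt hx.le, sq_nonneg (√(x + 1) - √x)]

theorem halfSum_succ (N : ℕ) :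
    halfSum (N + 1) = halfSum N + 1 / √((N : ℝ) + 1) - 2 * (√((N : ℝ) + 1) - √N) := by
  rw [halfSum, halfSum, Finset.sum_range_succ, Nat.cast_add_one]
  ring

theorem abs_halfSum_sub_le {N M : ℕ} (hN : 0 < N) (hM : N ≤ M) :
    |halfSum M - halfSum N| ≤ 1 / √(N : ℝ) := by
  -- `halfSum M` decreases in `M`, while `halfSum M - 1 / √M` increases.
  have h : halfSum M ≤ halfSum N ∧ halfSum N - 1 / √(N : ℝ) ≤ halfSum M - 1 / √(M : ℝ) := by
    induction M, hM using Nat.le_induction with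
    | base => simp
    | succ M hM ih =>
      have hle := one_div_sqrt_add_one_le M.cast_nonneg
      have hge := two_mul_sqrt_add_one_sub_sqrt_le (x := M) (Nat.cast_pos.2 (hN.trans_le hM))
      rw [halfSum_succ, Nat.cast_add_one]
      constructor <;> linarith [ih.1, ih.2]
  have hpos : 0 ≤ 1 / √(M : ℝ) := by positivity
  rw [abs_le]
  constructor <;> linarith [h.1, h.2]

theorem norm_halfSum_sub_riemannZeta_le {N : ℕ} (hN : 0 < N) :
    ‖(halfSum N : ℂ) - riemannZeta (1 / 2)‖ ≤ 1 / √(N : ℝ) := by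
  have h := (tendsto_const_nhds (x := (halfSum N : ℂ))).sub tendsto_halfSum
  refine le_of_tendsto h.norm ?_
  filter_upwards [eventually_ge_atTop N] with M hM
  rw [norm_sub_rev, ← Complex.ofReal_sub, Complex.norm_real]
  exact abs_halfSum_sub_le hN hM

theorem sum_one_div_sqrt_harmonicEigenvalue (n : ℕ) :
    ∑ k ∈ Finset.range (n + 1), 1 / √(harmonicEigenvalue k)
      = ∑ j ∈ Finset.range (2 * n + 1), 1 / √((j : ℝ) + 1)
        - 1 / √2 * ∑ j ∈ Finset.range n, 1 / √((j : ℝ) + 1) := by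
  induction n with
  | zero => simp [harmonicEigenvalue]
  | succ n ih =>
    have hsqrt : √(((2 * n + 1 : ℕ) : ℝ) + 1) = √2 * √((n : ℝ) + 1) := by
      rw [← Real.sqrt_mul (by norm_num)]; push_cast; ring_nf
    rw [Finset.sum_range_succ, ih, show 2 * (n + 1) + 1 = 2 * n + 1 + 1 + 1 by ring,
      Finset.sum_range_succ _ (2 * n + 1 + 1), Finset.sum_range_succ _ (2 * n + 1),
      Finset.sum_range_succ _ n, hsqrt, harmonicEigenvalue]
    push_cast
    field_simp
    ring_nf

theorem chi_add_spectralZeta_eq (n : ℕ) :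
    (chi n : ℂ) - -spectralZeta (1 / 2)
      = ((gammaTerm n - √(2 * n) : ℝ) : ℂ) - ((2 * (√(2 * (n : ℝ) + 1) - √(2 * n)) : ℝ) : ℂ)
        - ((halfSum (2 * n + 1) : ℂ) - riemannZeta (1 / 2))
        + ((1 / √2 : ℝ) : ℂ) * ((halfSum n : ℂ) - riemannZeta (1 / 2)) := by
  have htwo : (2 : ℂ) ^ (-(1 / 2) : ℂ) = ((1 / √2 : ℝ) : ℂ) := by
    rw [Complex.cpow_neg, one_div (√2), Complex.ofReal_inv, ← ofReal_cpow_one_half zero_le_two,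
      Complex.ofReal_ofNat]
  have hsum : ∑ k ∈ Finset.range (n + 1), 1 / √(harmonicEigenvalue k)
      = halfSum (2 * n + 1) + 2 * √(2 * n + 1) - 1 / √2 * halfSum n - √(2 * n) := by
    have hsq : √(2 : ℝ) ^ 2 = 2 := Real.sq_sqrt zero_le_two
    rw [sum_one_div_sqrt_harmonicEigenvalue, halfSum, halfSum, Real.sqrt_mul zero_le_two]
    push_cast
    field_simp
    linear_combination √(n : ℝ) * hsq
  rw [chi_eq, hsum, spectralZeta, htwo]
  push_cast
  ring

theorem norm_chi_add_spectralZeta_le {n : ℕ} (hn : 0 < n) :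
    ‖(chi n : ℂ) - -spectralZeta (1 / 2)‖ ≤ 8 * (1 / √(n : ℝ)) := by
  have hn' : (0 : ℝ) < n := Nat.cast_pos.2 hn
  have hmono {x : ℝ} (hx : n ≤ x) : 1 / √x ≤ 1 / √(n : ℝ) :=
    one_div_le_one_div_of_le (by positivity) (Real.sqrt_le_sqrt hx)
  have hgamma : ‖((gammaTerm n - √(2 * n) : ℝ) : ℂ)‖ ≤ 5 * (1 / √(n : ℝ)) := by
    rw [Complex.norm_real, mul_one_div]
    exact abs_gammaTerm_sub_sqrt_le hn
  have hsqrt : ‖((2 * (√(2 * (n : ℝ) + 1) - √(2 * n)) : ℝ) : ℂ)‖ ≤ 1 / √(n : ℝ) := by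
    have hle : √(2 * (n : ℝ)) ≤ √(2 * n + 1) := Real.sqrt_le_sqrt (by linarith)
    rw [Complex.norm_real, Real.norm_of_nonneg (by linarith)]
    exact (two_mul_sqrt_add_one_sub_sqrt_le (by positivity)).trans (hmono (by linarith))
  have hodd := (norm_halfSum_sub_riemannZeta_le (show 0 < 2 * n + 1 by lia)).trans
    (hmono (by push_cast; linarith))
  have heven : ‖((1 / √2 : ℝ) : ℂ) * ((halfSum n : ℂ) - riemannZeta (1 / 2))‖
      ≤ 1 / √(n : ℝ) := by
    rw [norm_mul, Complex.norm_real, Real.norm_of_nonneg (by positivity)]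
    refine (mul_le_of_le_one_left (norm_nonneg _) ?_).trans (norm_halfSum_sub_riemannZeta_le hn)
    exact div_le_one_of_le₀ (Real.one_le_sqrt.2 one_le_two) (by positivity)
  rw [chi_add_spectralZeta_eq]
  refine (norm_add_le_of_le (norm_sub_le_of_le (norm_sub_le_of_le hgamma hsqrt) hodd)
    heven).trans ?_
  linarith

theorem isBigO_chi_add_spectralZeta :
    (fun n : ℕ => (chi n : ℂ) - -spectralZeta (1 / 2)) =O[atTop] (fun n : ℕ => 1 / √(n : ℝ)) := by
  refine Asymptotics.IsBigO.of_bound 8 ?_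
  filter_upwards [eventually_gt_atTop 0] with n hn
  rw [Real.norm_of_nonneg (by positivity)]
  exact norm_chi_add_spectralZeta_le hn

/-! ### Orthonormality and completeness of the Hermite functions -/

/-- Continuous functions which, even after multiplication by any power of `x`, decay at least like
`exp (-x² / 4)`: a class of test functions containing the Hermite functions (whose true rate is
`exp (-x² / 2)`) and closed under the operations below. -/
structure GaussianDecay (f : ℝ → ℝ) : Prop where
  continuous : Continuous f
  exists_abs_pow_mul_le : ∀ n : ℕ, ∃ C, ∀ x, |x ^ n * f x| ≤ C * Real.exp (-x ^ 2 / 4)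

/-- Functions of at most exponential growth; they can be integrated against functions with
`GaussianDecay`. -/
def ExpBounded (m : ℝ → ℝ) : Prop := ∃ A c : ℝ, ∀ x, |m x| ≤ A * Real.exp (c * |x|)

namespace GaussianDecay

variable {f g : ℝ → ℝ}

theorem const_mul (hf : GaussianDecay f) (c : ℝ) : GaussianDecay (fun x => c * f x) := by
  refine ⟨hf.continuous.const_mul c, fun n => ?_⟩
  obtain ⟨C, hC⟩ := hf.exists_abs_pow_mul_le n
  refine ⟨|c| * C, fun x => ?_⟩
  rw [mul_left_comm, abs_mul, mul_assoc]
  gcongr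
  exact hC x

theorem sub (hf : GaussianDecay f) (hg : GaussianDecay g) :
    GaussianDecay (fun x => f x - g x) := by
  refine ⟨hf.continuous.sub hg.continuous, fun n => ?_⟩
  obtain ⟨C, hC⟩ := hf.exists_abs_pow_mul_le n
  obtain ⟨D, hD⟩ := hg.exists_abs_pow_mul_le n
  refine ⟨C + D, fun x => ?_⟩
  rw [mul_sub, add_mul]
  exact (abs_sub _ _).trans (add_le_add (hC x) (hD x))

theorem pow_mul (hf : GaussianDecay f) (n : ℕ) : GaussianDecay (fun x => x ^ n * f x) := by
  refine ⟨(continuous_pow n).mul hf.continuous, fun m => ?_⟩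
  obtain ⟨C, hC⟩ := hf.exists_abs_pow_mul_le (m + n)
  exact ⟨C, fun x => by simpa only [pow_add, mul_assoc] using hC x⟩

theorem id_mul (hf : GaussianDecay f) : GaussianDecay (fun x => x * f x) := by
  simpa only [pow_one] using hf.pow_mul 1

theorem exists_abs_le (hf : GaussianDecay f) :
    ∃ C, 0 ≤ C ∧ ∀ x, |f x| ≤ C * Real.exp (-x ^ 2 / 4) := by
  obtain ⟨C, hC⟩ := hf.exists_abs_pow_mul_le 0
  simp only [pow_zero, one_mul] at hC
  exact ⟨C, by simpa using (abs_nonneg _).trans (hC 0), hC⟩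

theorem exists_abs_le_const (hf : GaussianDecay f) : ∃ C, ∀ x, |f x| ≤ C := by
  obtain ⟨C, hC, hfC⟩ := hf.exists_abs_le
  refine ⟨C, fun x => (hfC x).trans (mul_le_of_le_one_right hC (Real.exp_le_one_iff.2 ?_))⟩
  linarith [sq_nonneg x]

end GaussianDecay

namespace ExpBounded

variable {m m₁ m₂ : ℝ → ℝ}

theorem exists_nonneg (hm : ExpBounded m) :
    ∃ A c : ℝ, 0 ≤ A ∧ ∀ x, |m x| ≤ A * Real.exp (c * |x|) := by
  obtain ⟨A, c, hA⟩ := hm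
  exact ⟨A, c, by simpa using (abs_nonneg _).trans (hA 0), hA⟩

theorem of_abs_le {M : ℝ} (h : ∀ x, |m x| ≤ M) : ExpBounded m := ⟨M, 0, by simpa using h⟩

theorem add (h₁ : ExpBounded m₁) (h₂ : ExpBounded m₂) : ExpBounded (fun x => m₁ x + m₂ x) := by
  obtain ⟨A, c, hA, hmA⟩ := h₁.exists_nonneg
  obtain ⟨B, d, hB, hmB⟩ := h₂.exists_nonneg
  refine ⟨A + B, max c d, fun x => ?_⟩
  calc |m₁ x + m₂ x| ≤ A * Real.exp (c * |x|) + B * Real.exp (d * |x|) :=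
        (abs_add_le _ _).trans (add_le_add (hmA x) (hmB x))
    _ ≤ A * Real.exp (max c d * |x|) + B * Real.exp (max c d * |x|) := by
        gcongr
        exacts [le_max_left _ _, le_max_right _ _]
    _ = (A + B) * Real.exp (max c d * |x|) := (add_mul _ _ _).symm

theorem const_mul (h : ExpBounded m) (c : ℝ) : ExpBounded (fun x => c * m x) := by
  obtain ⟨A, d, hA⟩ := h
  refine ⟨|c| * A, d, fun x => ?_⟩
  rw [abs_mul, mul_assoc]
  gcongr
  exact hA x

theorem sub (h₁ : ExpBounded m₁) (h₂ : ExpBounded m₂) : ExpBounded (fun x => m₁ x - m₂ x) := by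
  simpa [← sub_eq_add_neg] using h₁.add (h₂.const_mul (-1))

theorem mul (h₁ : ExpBounded m₁) (h₂ : ExpBounded m₂) : ExpBounded (fun x => m₁ x * m₂ x) := by
  obtain ⟨A, c, hA, hmA⟩ := h₁.exists_nonneg
  obtain ⟨B, d, hmB⟩ := h₂
  refine ⟨A * B, c + d, fun x => ?_⟩
  calc |m₁ x * m₂ x| ≤ A * Real.exp (c * |x|) * (B * Real.exp (d * |x|)) := by
        rw [abs_mul]; gcongr; exacts [hmA x, hmB x]
    _ = A * B * Real.exp ((c + d) * |x|) := by rw [add_mul, Real.exp_add]; ring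

end ExpBounded

theorem integrable_exp_neg_abs : Integrable (fun x : ℝ => Real.exp (-|x|)) := by
  refine Integrable.of_integral_ne_zero ?_
  rw [integral_comp_abs (f := fun x => Real.exp (-x)), integral_exp_neg_Ioi_zero]
  norm_num

theorem expBounded_id : ExpBounded (fun x => x) :=
  ⟨1, 1, fun x => by simpa using (lt_add_one |x|).le.trans (Real.add_one_le_exp |x|)⟩

namespace GaussianDecay

variable {f m : ℝ → ℝ}

theorem expBounded (hf : GaussianDecay f) : ExpBounded f :=
  ExpBounded.of_abs_le hf.exists_abs_le_const.choose_spec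

theorem exists_abs_mul_le (hf : GaussianDecay f) (hm : ExpBounded m) (t : ℝ) :
    ∃ K, ∀ x, |m x * f x| ≤ K * Real.exp (-(t * |x|)) := by
  obtain ⟨A, c, hA, hmA⟩ := hm.exists_nonneg
  obtain ⟨C, hC, hfC⟩ := hf.exists_abs_le
  refine ⟨A * C * Real.exp ((t + c) ^ 2), fun x => ?_⟩
  calc |m x * f x| ≤ A * Real.exp (c * |x|) * (C * Real.exp (-x ^ 2 / 4)) := by
        rw [abs_mul]; gcongr; exacts [hmA x, hfC x]
    _ = A * C * Real.exp (c * |x| + -x ^ 2 / 4) := by rw [Real.exp_add]; ring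
    _ ≤ A * C * Real.exp ((t + c) ^ 2 + -(t * |x|)) := by
        gcongr A * C * Real.exp ?_
        linarith [sq_nonneg (|x| / 2 - (t + c)), sq_abs x]
    _ = A * C * Real.exp ((t + c) ^ 2) * Real.exp (-(t * |x|)) := by rw [Real.exp_add]; ring

theorem integrable_exp_mul_mul (hf : GaussianDecay f) (hm : AEStronglyMeasurable m)
    (hm' : ExpBounded m) (t : ℝ) : Integrable (fun x => Real.exp (t * |x|) * (m x * f x)) := by
  obtain ⟨K, hK⟩ := hf.exists_abs_mul_le hm' (t + 1)
  refine (integrable_exp_neg_abs.const_mul K).mono'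
    (AEStronglyMeasurable.mul (by fun_prop) (hm.mul hf.continuous.aestronglyMeasurable))
    (Eventually.of_forall fun x => ?_)
  calc ‖Real.exp (t * |x|) * (m x * f x)‖ = Real.exp (t * |x|) * |m x * f x| := by
        rw [norm_mul, Real.norm_of_nonneg (Real.exp_pos _).le, Real.norm_eq_abs]
    _ ≤ Real.exp (t * |x|) * (K * Real.exp (-((t + 1) * |x|))) := by gcongr; exact hK x
    _ = K * Real.exp (-|x|) := by rw [mul_left_comm, ← Real.exp_add]; ring_nf

theorem integrable_mul (hf : GaussianDecay f) (hm : AEStronglyMeasurable m)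
    (hm' : ExpBounded m) : Integrable (fun x => m x * f x) := by
  simpa using hf.integrable_exp_mul_mul hm hm' 0

theorem integrable (hf : GaussianDecay f) : Integrable f := by
  simpa using hf.integrable_mul (m := fun _ => 1) (by fun_prop)
    (ExpBounded.of_abs_le (M := 1) (by simp))

theorem tendsto_mul_cocompact (hf : GaussianDecay f) (hm : ExpBounded m) :
    Tendsto (fun x => m x * f x) (cocompact ℝ) (𝓝 0) := by
  obtain ⟨K, hK⟩ := hf.exists_abs_mul_le hm 1
  simp only [one_mul] at hK
  refine squeeze_zero_norm hK ?_
  simpa using (Real.tendsto_exp_neg_atTop_nhds_zero.comp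
    (tendsto_norm_cocompact_atTop (E := ℝ))).const_mul K

theorem tendsto_mul_atTop (hf : GaussianDecay f) (hm : ExpBounded m) :
    Tendsto (fun x => m x * f x) atTop (𝓝 0) :=
  (hf.tendsto_mul_cocompact hm).mono_left atTop_le_cocompact

theorem tendsto_mul_atBot (hf : GaussianDecay f) (hm : ExpBounded m) :
    Tendsto (fun x => m x * f x) atBot (𝓝 0) :=
  (hf.tendsto_mul_cocompact hm).mono_left atBot_le_cocompact

end GaussianDecay

theorem gaussianDecay_gaussian : GaussianDecay (fun x => Real.exp (-x ^ 2 / 2)) := by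
  refine ⟨by fun_prop, fun n => ⟨n.factorial * Real.exp 1, fun x => ?_⟩⟩
  have hpow : |x| ^ n ≤ n.factorial * Real.exp |x| := by
    rw [mul_comm, ← div_le_iff₀ (by positivity)]
    exact Real.pow_div_factorial_le_exp |x| (abs_nonneg x) n
  calc |x ^ n * Real.exp (-x ^ 2 / 2)| = |x| ^ n * Real.exp (-x ^ 2 / 2) := by
        rw [abs_mul, abs_pow, Real.abs_exp]
    _ ≤ n.factorial * Real.exp |x| * Real.exp (-x ^ 2 / 2) := by gcongr
    _ = n.factorial * Real.exp (|x| + -x ^ 2 / 2) := by rw [Real.exp_add]; ring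
    _ ≤ n.factorial * Real.exp (1 + -x ^ 2 / 4) := by
        gcongr n.factorial * Real.exp ?_
        linarith [sq_nonneg (|x| / 2 - 1), sq_abs x]
    _ = n.factorial * Real.exp 1 * Real.exp (-x ^ 2 / 4) := by rw [Real.exp_add]; ring

theorem gaussianDecay_hermiteFn (k : ℕ) : GaussianDecay (hermiteFn k) := by
  induction k using Nat.strong_induction_on with
  | _ k ih =>
    cases k with
    | zero =>
      rw [funext hermiteFn_zero]
      exact gaussianDecay_gaussian.const_mul √(1 / √π)
    | succ n =>
      convert (((ih n (by lia)).id_mul.const_mul 2).sub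
        ((ih (n - 1) (by lia)).const_mul (ladder n))).const_mul (ladder (n + 1))⁻¹ using 2 with x
      rw [hermiteFn]
      ring

theorem gaussianDecay_deriv_hermiteFn (k : ℕ) : GaussianDecay (deriv (hermiteFn k)) := by
  rw [deriv_hermiteFn]
  exact (gaussianDecay_hermiteFn k).id_mul.sub ((gaussianDecay_hermiteFn (k + 1)).const_mul _)

theorem gaussianDecay_deriv_deriv_hermiteFn (k : ℕ) :
    GaussianDecay (deriv (deriv (hermiteFn k))) := by
  simpa only [deriv_deriv_hermiteFn, sub_mul] using
    ((gaussianDecay_hermiteFn k).pow_mul 2).sub ((gaussianDecay_hermiteFn k).const_mul _)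

theorem integrable_hermiteFn_mul (j k : ℕ) :
    Integrable (fun x => hermiteFn j x * hermiteFn k x) :=
  (gaussianDecay_hermiteFn k).integrable_mul (continuous_hermiteFn j).aestronglyMeasurable
    (gaussianDecay_hermiteFn j).expBounded

-- The Wronskian of `h_j` and `h_k` vanishes at `±∞` and has derivative `(2j - 2k) h_j h_k`.
theorem integral_hermiteFn_mul_of_ne {j k : ℕ} (hjk : j ≠ k) :
    ∫ x, hermiteFn j x * hermiteFn k x = 0 := by
  have hwronskian (x : ℝ) : HasDerivAt
      (fun x => hermiteFn j x * deriv (hermiteFn k) x - hermiteFn k x * deriv (hermiteFn j) x)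
      ((2 * j - 2 * k) * (hermiteFn j x * hermiteFn k x)) x := by
    refine (((differentiable_hermiteFn j x).hasDerivAt.mul (hasDerivAt_deriv_hermiteFn k x)).sub
      ((differentiable_hermiteFn k x).hasDerivAt.mul
        (hasDerivAt_deriv_hermiteFn j x))).congr_deriv ?_
    unfold harmonicEigenvalue
    ring
  have hexp (i : ℕ) := (gaussianDecay_hermiteFn i).expBounded
  have hderiv (i : ℕ) := gaussianDecay_deriv_hermiteFn i
  have hintegral := integral_of_hasDerivAt_of_tendsto hwronskian
    ((integrable_hermiteFn_mul j k).const_mul _)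
    (((hderiv k).tendsto_mul_atBot (hexp j)).sub ((hderiv j).tendsto_mul_atBot (hexp k)))
    (((hderiv k).tendsto_mul_atTop (hexp j)).sub ((hderiv j).tendsto_mul_atTop (hexp k)))
  rw [integral_const_mul, sub_self, ← mul_sub] at hintegral
  simpa [sub_eq_zero, hjk] using hintegral

theorem integral_hermiteFn_zero_sq : ∫ x, hermiteFn 0 x * hermiteFn 0 x = 1 := by
  have hsq (x : ℝ) : hermiteFn 0 x * hermiteFn 0 x = 1 / √π * Real.exp (-1 * x ^ 2) := by
    rw [hermiteFn_zero, mul_mul_mul_comm, Real.mul_self_sqrt (by positivity), ← Real.exp_add]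
    ring_nf
  simp_rw [hsq]
  rw [integral_const_mul, integral_gaussian, div_one,
    one_div_mul_cancel (Real.sqrt_pos.2 Real.pi_pos).ne']

-- Compute `∫ 2 x h_k h_{k+1}` with the recurrence for `h_k` and with that for `h_{k+1}`.
theorem integral_hermiteFn_sq (k : ℕ) : ∫ x, hermiteFn k x * hermiteFn k x = 1 := by
  induction k with
  | zero => exact integral_hermiteFn_zero_sq
  | succ k ih =>
    have hrec (x : ℝ) : ladder (k + 1) * (hermiteFn (k + 1) x * hermiteFn (k + 1) x)
        + ladder k * (hermiteFn (k - 1) x * hermiteFn (k + 1) x)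
        = ladder (k + 2) * (hermiteFn k x * hermiteFn (k + 2) x)
        + ladder (k + 1) * (hermiteFn k x * hermiteFn k x) := by
      have hk := two_mul_mul_hermiteFn k x
      have hk' := two_mul_mul_hermiteFn (k + 1) x
      simp only [Nat.add_sub_cancel] at hk'
      linear_combination (-hermiteFn (k + 1) x) * hk + hermiteFn k x * hk'
    have hint (c : ℝ) (i j : ℕ) := (integrable_hermiteFn_mul i j).const_mul c
    have h := integral_congr_ae (μ := volume) (Eventually.of_forall hrec)
    rw [integral_add (hint _ _ _) (hint _ _ _), integral_add (hint _ _ _) (hint _ _ _)] at h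
    simp only [integral_const_mul] at h
    rw [integral_hermiteFn_mul_of_ne (show k - 1 ≠ k + 1 by lia),
      integral_hermiteFn_mul_of_ne (show k ≠ k + 2 by lia), ih] at h
    simpa [(ladder_succ_pos k).ne'] using h

theorem integral_hermiteFn_mul (j k : ℕ) :
    ∫ x, hermiteFn j x * hermiteFn k x = if j = k then 1 else 0 := by
  split_ifs with h
  · rw [h, integral_hermiteFn_sq]
  · exact integral_hermiteFn_mul_of_ne h

theorem id_mul_mem_span_hermiteFn {f : ℝ → ℝ} (hf : f ∈ Submodule.span ℝ (Set.range hermiteFn)) :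
    (fun x => x * f x) ∈ Submodule.span ℝ (Set.range hermiteFn) := by
  suffices Set.range hermiteFn ⊆ (Submodule.span ℝ (Set.range hermiteFn)).comap
    (LinearMap.mulLeft ℝ (fun x : ℝ => x)) from Submodule.span_le.2 this hf
  rintro _ ⟨k, rfl⟩
  have hmul : (fun x => x * hermiteFn k x) = (ladder (k + 1) / 2) • hermiteFn (k + 1)
      + (ladder k / 2) • hermiteFn (k - 1) := by
    ext x
    simp only [Pi.add_apply, Pi.smul_apply, smul_eq_mul]
    linear_combination two_mul_mul_hermiteFn k x / 2
  change (fun x => x * hermiteFn k x) ∈ Submodule.span ℝ (Set.range hermiteFn)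
  rw [hmul]
  exact add_mem (Submodule.smul_mem _ _ (Submodule.subset_span ⟨_, rfl⟩))
    (Submodule.smul_mem _ _ (Submodule.subset_span ⟨_, rfl⟩))

theorem pow_mul_hermiteFn_zero_mem_span (n : ℕ) :
    (fun x => x ^ n * hermiteFn 0 x) ∈ Submodule.span ℝ (Set.range hermiteFn) := by
  induction n with
  | zero =>
    simp only [pow_zero, one_mul]
    exact Submodule.subset_span (Set.mem_range_self 0)
  | succ n ih => simpa only [pow_succ', mul_assoc] using id_mul_mem_span_hermiteFn ih

theorem integral_mul_eq_zero_of_mem_span {f g : ℝ → ℝ} (hf : AEStronglyMeasurable f)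
    (hf' : ExpBounded f) (h : ∀ k, ∫ x, f x * hermiteFn k x = 0)
    (hg : g ∈ Submodule.span ℝ (Set.range hermiteFn)) : ∫ x, f x * g x = 0 := by
  suffices Integrable (fun x => f x * g x) ∧ ∫ x, f x * g x = 0 from this.2
  induction hg using Submodule.span_induction with
  | mem g hg =>
    obtain ⟨k, rfl⟩ := hg
    exact ⟨(gaussianDecay_hermiteFn k).integrable_mul hf hf', h k⟩
  | zero => simp
  | add g₁ g₂ _ _ h₁ h₂ =>
    simp only [Pi.add_apply, mul_add]
    exact ⟨h₁.1.add h₂.1, by rw [integral_add h₁.1 h₂.1, h₁.2, h₂.2, add_zero]⟩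
  | smul c g _ hg =>
    simp only [Pi.smul_apply, smul_eq_mul, mul_left_comm _ c]
    exact ⟨hg.1.const_mul c, by rw [integral_const_mul, hg.2, mul_zero]⟩

theorem norm_mul_pow_div_factorial (c : ℂ) (v : ℝ) (n : ℕ) :
    ‖(c * v) ^ n / (n.factorial : ℂ)‖ = (‖c‖ * |v|) ^ n / n.factorial := by
  rw [norm_div, norm_pow, norm_mul, Complex.norm_real, Real.norm_eq_abs, Complex.norm_natCast]

theorem tsum_mul_pow_div_factorial (c v : ℝ) :
    ∑' n : ℕ, (c * v) ^ n / (n.factorial : ℝ) = Real.exp (c * v) := by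
  rw [Real.exp_eq_exp_ℝ, (NormedSpace.expSeries_div_hasSum_exp (c * v)).tsum_eq]

-- Expand the exponential in the Fourier integral into its power series.
theorem integral_cexp_mul_eq_zero_of_moments_eq_zero {F : ℝ → ℂ} (hF : AEStronglyMeasurable F)
    (hexp : ∀ t : ℝ, Integrable fun x => Real.exp (t * |x|) * ‖F x‖)
    (hmoment : ∀ n : ℕ, ∫ x : ℝ, (x : ℂ) ^ n * F x = 0) (c : ℂ) :
    ∫ x : ℝ, Complex.exp (c * x) * F x = 0 := by
  have hsum := hasSum_integral_of_dominated_convergence (μ := volume)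
    (F := fun (n : ℕ) (v : ℝ) => (c * v) ^ n / (n.factorial : ℂ) * F v)
    (f := fun v => Complex.exp (c * v) * F v)
    (fun n v => (‖c‖ * |v|) ^ n / n.factorial * ‖F v‖)
    (fun n => by fun_prop)
    (fun n => Eventually.of_forall fun v => by rw [norm_mul, norm_mul_pow_div_factorial])
    (Eventually.of_forall fun v => (Real.summable_pow_div_factorial _).mul_right _)
    (by simpa only [tsum_mul_right, tsum_mul_pow_div_factorial] using hexp ‖c‖)
    (Eventually.of_forall fun v => by
      rw [Complex.exp_eq_exp_ℂ]
      exact (NormedSpace.expSeries_div_hasSum_exp (c * (v : ℂ))).mul_right (F v))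
  have hterm (n : ℕ) : ∫ v : ℝ, (c * v) ^ n / (n.factorial : ℂ) * F v = 0 := by
    simp_rw [mul_pow, mul_div_right_comm, mul_assoc]
    rw [integral_const_mul, hmoment, mul_zero]
  simp_rw [hterm] at hsum
  exact hsum.unique hasSum_zero

open scoped FourierTransform in
theorem fourier_eq_zero_of_moments_eq_zero {F : ℝ → ℂ} (hF : AEStronglyMeasurable F)
    (hexp : ∀ t : ℝ, Integrable fun x => Real.exp (t * |x|) * ‖F x‖)
    (hmoment : ∀ n : ℕ, ∫ x : ℝ, (x : ℂ) ^ n * F x = 0) : 𝓕 F = 0 := by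
  ext ξ
  rw [Real.fourier_eq', Pi.zero_apply,
    ← integral_cexp_mul_eq_zero_of_moments_eq_zero hF hexp hmoment (-2 * π * ξ * Complex.I)]
  congr! 4 with v
  simp only [RCLike.inner_apply, conj_trivial, Complex.ofReal_mul,
    Complex.ofReal_neg, Complex.ofReal_ofNat]
  ring

theorem eq_zero_of_integral_mul_hermiteFn {f : ℝ → ℝ} (hf : Continuous f) (hb : ExpBounded f)
    (h : ∀ k, ∫ x, f x * hermiteFn k x = 0) : f = 0 := by
  set F : ℝ → ℂ := fun x => ((f x * hermiteFn 0 x : ℝ) : ℂ) with hF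
  have hFc : Continuous F := by fun_prop
  have hexp (t : ℝ) : Integrable fun x => Real.exp (t * |x|) * ‖F x‖ := by
    simpa [hF, abs_mul] using ((gaussianDecay_hermiteFn 0).integrable_exp_mul_mul
      hf.aestronglyMeasurable hb t).norm
  have hFi : Integrable F :=
    ((gaussianDecay_hermiteFn 0).integrable_mul hf.aestronglyMeasurable hb).ofReal
  have hmoment (n : ℕ) : ∫ x : ℝ, (x : ℂ) ^ n * F x = 0 := by
    have hreal (x : ℝ) : (x : ℂ) ^ n * F x = ((f x * (x ^ n * hermiteFn 0 x) : ℝ) : ℂ) := by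
      simp only [hF]; push_cast; ring
    simp_rw [hreal]
    rw [integral_complex_ofReal, integral_mul_eq_zero_of_mem_span hf.aestronglyMeasurable hb h
      (pow_mul_hermiteFn_zero_mem_span n), Complex.ofReal_zero]
  have hfourier := fourier_eq_zero_of_moments_eq_zero hFc.aestronglyMeasurable hexp hmoment
  have hF0 : F = 0 := by
    rw [← hFc.fourierInv_fourier_eq hFi (by rw [hfourier]; exact integrable_zero _ _ _), hfourier]
    ext x
    simp [Real.fourierInv_eq']
  ext x
  have hne : hermiteFn 0 x ≠ 0 := by rw [hermiteFn_zero]; positivity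
  have hx : f x * hermiteFn 0 x = 0 := Complex.ofReal_eq_zero.1 (congrFun hF0 x)
  exact (mul_eq_zero.1 hx).resolve_right hne

theorem christoffel_le_sqrt (n : ℕ) (x : ℝ) : christoffel n x ≤ √((n : ℝ) + 1) := by
  refine (christoffel_le n x).trans ((div_le_iff₀ Real.pi_pos).2 ?_)
  refine le_of_sq_le_sq ?_ (by positivity)
  have hπ : 3 ^ 2 ≤ π ^ 2 := pow_le_pow_left₀ (by norm_num) Real.pi_gt_three.le 2
  calc gammaTerm n ^ 2 ≤ 2 * n + 5 := gammaTerm_sq_le n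
    _ ≤ (n + 1) * 3 ^ 2 := by linarith
    _ ≤ (√((n : ℝ) + 1) * π) ^ 2 := by
      rw [mul_pow, Real.sq_sqrt (by positivity)]
      gcongr

theorem sqrt_mul_inv_harmonicEigenvalue_sub_le (n : ℕ) :
    √((n : ℝ) + 1) * (1 / harmonicEigenvalue n - 1 / harmonicEigenvalue (n + 1))
      ≤ 4 * (1 / √((n : ℝ) + 1) - 1 / √((n : ℝ) + 2)) := by
  set a := √((n : ℝ) + 1)
  set b := √((n : ℝ) + 2)
  have ha : 0 < a := by positivity
  have hb : 0 < b := by positivity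
  have ha2 : a ^ 2 = n + 1 := Real.sq_sqrt (by positivity)
  have hb2 : b ^ 2 = n + 2 := Real.sq_sqrt (by positivity)
  have hab : a ≤ b := Real.sqrt_le_sqrt (by linarith)
  calc a * (1 / harmonicEigenvalue n - 1 / harmonicEigenvalue (n + 1))
      = 2 * a ^ 2 / ((2 * n + 1) * (2 * n + 3)) / a := by
        unfold harmonicEigenvalue
        push_cast
        field_simp
        ring
    _ ≤ 4 / (b * (b + b)) / a := by
        gcongr ?_ / a
        rw [div_le_div_iff₀ (by positivity) (by positivity)]
        calc 2 * a ^ 2 * (b * (b + b)) = 4 * (a ^ 2 * b ^ 2) := by ring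
          _ ≤ 4 * ((2 * (n : ℝ) + 1) * (2 * n + 3)) := by rw [ha2, hb2]; gcongr <;> linarith
    _ ≤ 4 / (b * (a + b)) / a := by gcongr
    _ = 4 * ((b ^ 2 - a ^ 2) / (a * b * (a + b))) := by rw [ha2, hb2]; field_simp; ring
    _ = 4 * (1 / a - 1 / b) := by field_simp; ring

-- Summation by parts, using that the partial sums `christoffel n x` are at most `√(n + 1)`.
theorem sum_range_succ_hermiteFn_sq_div_le (n : ℕ) (x : ℝ) :
    ∑ k ∈ Finset.range (n + 1), hermiteFn k x ^ 2 / harmonicEigenvalue k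
      ≤ christoffel n x / harmonicEigenvalue n + 4 * (1 - 1 / √((n : ℝ) + 1)) := by
  induction n with
  | zero => simp [christoffel]
  | succ n ih =>
    have hstep : christoffel n x * (1 / harmonicEigenvalue n - 1 / harmonicEigenvalue (n + 1))
        ≤ 4 * (1 / √((n : ℝ) + 1) - 1 / √((n : ℝ) + 2)) := by
      refine (mul_le_mul_of_nonneg_right (christoffel_le_sqrt n x) ?_).trans
        (sqrt_mul_inv_harmonicEigenvalue_sub_le n)
      rw [sub_nonneg]
      unfold harmonicEigenvalue
      gcongr
      simp
    rw [Finset.sum_range_succ, christoffel_succ]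
    push_cast
    rw [add_assoc (n : ℝ), one_add_one_eq_two, add_div]
    linear_combination ih + hstep

theorem sum_hermiteFn_sq_div_le (n : ℕ) (x : ℝ) :
    ∑ k ∈ Finset.range n, hermiteFn k x ^ 2 / harmonicEigenvalue k ≤ 5 := by
  have hchristoffel : christoffel n x / harmonicEigenvalue n ≤ 1 := by
    unfold harmonicEigenvalue
    rw [div_le_one (by positivity)]
    refine (christoffel_le_sqrt n x).trans ((Real.sqrt_le_left (by positivity)).2 ?_)
    nlinarith [(Nat.cast_nonneg n : (0 : ℝ) ≤ n)]
  have hpos : 0 < 1 / √((n : ℝ) + 1) := by positivity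
  calc ∑ k ∈ Finset.range n, hermiteFn k x ^ 2 / harmonicEigenvalue k
      ≤ ∑ k ∈ Finset.range (n + 1), hermiteFn k x ^ 2 / harmonicEigenvalue k := by
        rw [Finset.sum_range_succ]
        unfold harmonicEigenvalue
        exact le_add_of_nonneg_right (by positivity)
    _ ≤ christoffel n x / harmonicEigenvalue n + 4 * (1 - 1 / √((n : ℝ) + 1)) :=
        sum_range_succ_hermiteFn_sq_div_le n x
    _ ≤ 5 := by linarith

/-! ### Compact positive operators -/

theorem exists_seq_forall_image_Iio {α : Type*} {P : α → Prop} {Q : Set α → α → Prop}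
    (h : ∀ s : Set α, s.Finite → (∀ x ∈ s, P x) → ∃ y, P y ∧ Q s y) :
    ∃ f : ℕ → α, ∀ n, P (f n) ∧ Q (f '' Set.Iio n) (f n) := by
  choose y hP hQ using fun s : {s : Set α // s.Finite ∧ ∀ x ∈ s, P x} => h s s.2.1 s.2.2
  let g : ℕ → {s : Set α // s.Finite ∧ ∀ x ∈ s, P x} := fun n => n.rec ⟨∅, by simp⟩ fun _ s =>
    ⟨insert (y s) s, s.2.1.insert _, Set.forall_mem_insert.2 ⟨hP s, s.2.2⟩⟩
  have hg (n : ℕ) : (g n).1 = (fun k => y (g k)) '' Set.Iio n := by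
    induction n with
    | zero => simp [g]
    | succ n ih =>
      rw [← Order.succ_eq_add_one, Order.Iio_succ_eq_insert, Set.image_insert_eq, ← ih]
      rfl
  exact ⟨fun k => y (g k), fun n => ⟨hP _, hg n ▸ hQ _⟩⟩

section HilbertSpace

variable {E : Type*} [NormedAddCommGroup E] [InnerProductSpace ℝ E]

theorem hasEigenvalue_norm [CompleteSpace E] {T : E →L[ℝ] E} (hT : IsCompactOperator T)
    (hpos : T.IsPositive) (h0 : T ≠ 0) :
    Module.End.HasEigenvalue (T : Module.End ℝ E) ‖T‖ := by
  have : Nontrivial E := by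
    by_contra h
    rw [not_nontrivial_iff_subsingleton] at h
    exact h0 (Subsingleton.elim _ _)
  refine (hT.hasEigenvalue_or_mem_resolventSet (norm_ne_zero_iff.2 h0)).resolve_right fun hres => ?_
  obtain ⟨ε, hε, hle⟩ := T.rayleighQuotient_le_of_norm_mem_resolventSet (𝕜 := ℝ) hres
  have hsup : ⨆ x, |T.rayleighQuotient x| ≤ ‖T‖ - ε := ciSup_le fun x => by
    rw [abs_of_nonneg (div_nonneg (hpos.2 x) (by positivity))]
    exact hle x
  linarith [T.norm_eq_iSup_rayleighQuotient hpos.isSymmetric]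

-- The witness is an eigenvector for the eigenvalue `‖S|_W‖` of the restriction of `S` to `W`.
theorem exists_max_eigenvector_mem {S : E →L[ℝ] E} (hS : IsCompactOperator S)
    (hpos : S.IsPositive) (hinj : Function.Injective S) {W : Submodule ℝ E} [CompleteSpace W]
    [Nontrivial W] (hW : ∀ z ∈ W, S z ∈ W) :
    ∃ y ∈ W, (‖y‖ = 1 ∧ S y = ‖S y‖ • y) ∧ ∀ z ∈ W, ‖S z‖ ≤ ‖S y‖ * ‖z‖ := by
  let T : W →L[ℝ] W := S.restrict hW
  have hTc : IsCompactOperator T := IsCompactOperator.restrict' (f := (S : E →ₗ[ℝ] E)) hS hW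
  have hTpos : T.IsPositive := ⟨fun x y => hpos.isSymmetric x y, fun x => hpos.2 x⟩
  have hT0 : T ≠ 0 := by
    obtain ⟨x, hx⟩ := exists_ne (0 : W)
    refine fun hT => hx (Subtype.ext (hinj ?_))
    exact (congrArg Subtype.val (DFunLike.congr_fun hT x)).trans (map_zero S).symm
  obtain ⟨v, hv, hv0⟩ := (hasEigenvalue_norm hTc hTpos hT0).exists_hasEigenvector
  have hSv : S v = ‖T‖ • (v : E) := congrArg Subtype.val (Module.End.mem_eigenspace_iff.1 hv)
  have hy : S ((‖v‖⁻¹ : ℝ) • (v : E)) = ‖T‖ • ((‖v‖⁻¹ : ℝ) • (v : E)) := by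
    rw [map_smul, hSv, smul_comm]
  have hy1 : ‖(‖v‖⁻¹ : ℝ) • (v : E)‖ = 1 := by
    rw [norm_smul, norm_inv, norm_norm]
    exact inv_mul_cancel₀ (norm_ne_zero_iff.2 hv0)
  have hSy : ‖S ((‖v‖⁻¹ : ℝ) • (v : E))‖ = ‖T‖ := by
    rw [hy, norm_smul, hy1, mul_one, Real.norm_of_nonneg (norm_nonneg T)]
  refine ⟨(‖v‖⁻¹ : ℝ) • (v : E), W.smul_mem _ v.2, ⟨hy1, by rw [hSy, hy]⟩, fun z hz => ?_⟩
  rw [hSy]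
  exact T.le_opNorm ⟨z, hz⟩

theorem exists_max_eigenvector_mem_orthogonal [CompleteSpace E] (hE : ¬ FiniteDimensional ℝ E)
    {S : E →L[ℝ] E} (hS : IsCompactOperator S) (hpos : S.IsPositive) (hinj : Function.Injective S)
    {s : Set E} (hfin : s.Finite) (heig : ∀ x ∈ s, ∃ c : ℝ, S x = c • x) :
    ∃ y ∈ (Submodule.span ℝ s)ᗮ, (‖y‖ = 1 ∧ S y = ‖S y‖ • y) ∧
      ∀ z ∈ (Submodule.span ℝ s)ᗮ, ‖S z‖ ≤ ‖S y‖ * ‖z‖ := by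
  have : FiniteDimensional ℝ (Submodule.span ℝ s) := FiniteDimensional.span_of_finite ℝ hfin
  have : Nontrivial (Submodule.span ℝ s)ᗮ := by
    rw [Submodule.nontrivial_iff_ne_bot, Ne, Submodule.orthogonal_eq_bot_iff]
    intro htop
    rw [htop] at this
    exact hE (Module.finite_def.2 (Module.Finite.iff_fg.1 this))
  refine exists_max_eigenvector_mem hS hpos hinj
    (hpos.isSymmetric.orthogonalComplement_mem_invtSubmodule (p := Submodule.span ℝ s)
      (Submodule.span_le.2 fun x hx => ?_))
  obtain ⟨c, hc⟩ := heig x hx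
  simpa [hc] using Submodule.smul_mem _ c (Submodule.subset_span hx)

theorem exists_abs_lt_of_orthonormal_eigenvectors {S : E →L[ℝ] E} (hS : IsCompactOperator S)
    {ψ : ℕ → E} (hψ : Orthonormal ℝ ψ) {c : ℕ → ℝ} (hc : ∀ n, S (ψ n) = c n • ψ n)
    {ε : ℝ} (hε : 0 < ε) : ∃ n, |c n| < ε := by
  by_contra! hge
  have hdist {m n : ℕ} (hmn : m ≠ n) : ‖S (ψ m) - S (ψ n)‖ ^ 2 = c m ^ 2 + c n ^ 2 := by
    rw [@norm_sub_sq_real, hc, hc, inner_smul_left, inner_smul_right, hψ.2 hmn]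
    simp [norm_smul, hψ.1]
  obtain ⟨K, hK, hKS⟩ := IsCompactOperator.image_closedBall_subset_compact
    (f := (S : E →ₗ[ℝ] E)) hS 1
  obtain ⟨_, _, φ, hφ, hlim⟩ := hK.tendsto_subseq fun n => hKS ⟨ψ n, by simp [hψ.1], rfl⟩
  obtain ⟨N, hN⟩ := Metric.cauchySeq_iff.1 hlim.cauchySeq ε hε
  have hlt : ‖S (ψ (φ (N + 1))) - S (ψ (φ N))‖ < ε := by
    simpa [dist_eq_norm] using hN (N + 1) (N.le_add_right 1) N le_rfl
  have hsq := hdist (hφ N.lt_succ_self).ne'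
  have hge_sq : ε ^ 2 ≤ c (φ N) ^ 2 := by
    rw [← sq_abs (c _)]
    exact pow_le_pow_left₀ hε.le (hge _) 2
  nlinarith [pow_lt_pow_left₀ hlt (norm_nonneg _) two_ne_zero, sq_nonneg (c (φ (N + 1)))]

theorem exists_orthonormal_max_eigenvectors [CompleteSpace E] (hE : ¬ FiniteDimensional ℝ E)
    {S : E →L[ℝ] E} (hS : IsCompactOperator S) (hpos : S.IsPositive)
    (hinj : Function.Injective S) :
    ∃ ψ : ℕ → E, Orthonormal ℝ ψ ∧ (∀ n, S (ψ n) = ‖S (ψ n)‖ • ψ n) ∧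
      ∀ n z, (∀ m < n, inner ℝ (ψ m) z = 0) → ‖S z‖ ≤ ‖S (ψ n)‖ * ‖z‖ := by
  obtain ⟨ψ, hψ⟩ := exists_seq_forall_image_Iio
    (P := fun y : E => ‖y‖ = 1 ∧ S y = ‖S y‖ • y)
    (Q := fun s y => y ∈ (Submodule.span ℝ s)ᗮ ∧
      ∀ z ∈ (Submodule.span ℝ s)ᗮ, ‖S z‖ ≤ ‖S y‖ * ‖z‖)
    fun s hfin hs => by
      obtain ⟨y, hy, hP, hmax⟩ := exists_max_eigenvector_mem_orthogonal hE hS hpos hinj hfin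
        fun x hx => ⟨_, (hs x hx).2⟩
      exact ⟨y, hP, hy, hmax⟩
  have horth {m n : ℕ} (hmn : m < n) : inner ℝ (ψ m) (ψ n) = 0 :=
    (Submodule.mem_orthogonal _ _).1 (hψ n).2.1 _ (Submodule.subset_span ⟨m, hmn, rfl⟩)
  refine ⟨ψ, ⟨fun n => (hψ n).1.1, fun m n hmn => ?_⟩, fun n => (hψ n).1.2, fun n z hz => ?_⟩
  · rcases lt_or_gt_of_ne hmn with hlt | hgt
    · exact horth hlt
    · rw [real_inner_comm, horth hgt]
  · refine (hψ n).2.2 z ((Submodule.mem_orthogonal _ _).2 fun x hx => ?_)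
    have hsub : Submodule.span ℝ (ψ '' Set.Iio n) ≤ LinearMap.ker (innerₛₗ ℝ z) :=
      Submodule.span_le.2 (by rintro _ ⟨m, hm, rfl⟩; simpa [real_inner_comm] using hz m hm)
    simpa [real_inner_comm] using hsub hx

theorem exists_antitone_hilbertBasis_eigenvectors [CompleteSpace E]
    (hE : ¬ FiniteDimensional ℝ E) {S : E →L[ℝ] E} (hS : IsCompactOperator S)
    (hpos : S.IsPositive) (hinj : Function.Injective S) :
    ∃ (ψ : HilbertBasis ℕ ℝ E) (c : ℕ → ℝ), Antitone c ∧ Tendsto c atTop (𝓝[>] 0) ∧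
      ∀ n, 0 < c n ∧ S (ψ n) = c n • ψ n := by
  obtain ⟨ψ, hψ, heig, hmax⟩ := exists_orthonormal_max_eigenvectors hE hS hpos hinj
  have hc_pos (n : ℕ) : 0 < ‖S (ψ n)‖ :=
    norm_pos_iff.2 ((map_ne_zero_iff S hinj).2 (hψ.ne_zero n))
  have hanti : Antitone fun n => ‖S (ψ n)‖ := antitone_nat_of_succ_le fun n => by
    simpa [hψ.1] using hmax n (ψ (n + 1)) fun m hm => hψ.2 (by lia)
  have hlim : Tendsto (fun n => ‖S (ψ n)‖) atTop (𝓝 0) := by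
    refine Metric.tendsto_atTop.2 fun ε hε => ?_
    obtain ⟨N, hN⟩ := exists_abs_lt_of_orthonormal_eigenvectors hS hψ heig hε
    refine ⟨N, fun n hn => ?_⟩
    rw [Real.dist_0_eq_abs, abs_norm]
    exact (hanti hn).trans_lt (by simpa using hN)
  have hcomplete : (Submodule.span ℝ (Set.range ψ))ᗮ = ⊥ := by
    refine (Submodule.eq_bot_iff _).2 fun x hx => hinj ?_
    have hle (n : ℕ) : ‖S x‖ ≤ ‖S (ψ n)‖ * ‖x‖ := hmax n x fun m _ =>
      (Submodule.mem_orthogonal _ _).1 hx _ (Submodule.subset_span ⟨m, rfl⟩)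
    rw [map_zero, ← norm_le_zero_iff]
    simpa using ge_of_tendsto' (hlim.mul_const ‖x‖) hle
  refine ⟨.mkOfOrthogonalEqBot hψ hcomplete, fun n => ‖S (ψ n)‖, hanti,
    tendsto_nhdsWithin_iff.2 ⟨hlim, Eventually.of_forall hc_pos⟩, fun n => ⟨hc_pos n, ?_⟩⟩
  simpa using heig n

/-! ### The generalized eigenvalue problem `T x = μ D² x` -/

/-- The eigenspace for `μ` of the generalized eigenvalue problem `T x = μ D (D x)`. -/
def pencilEigenspace (T D : E →L[ℝ] E) (μ : ℝ) : Submodule ℝ E :=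
  LinearMap.ker (T - μ • D ∘L D : E →L[ℝ] E).toLinearMap

theorem mem_pencilEigenspace {T D : E →L[ℝ] E} {μ : ℝ} {x : E} :
    x ∈ pencilEigenspace T D μ ↔ T x = μ • D (D x) := by
  simp [pencilEigenspace, sub_eq_zero]

/-- A complete system of eigenvectors for the generalized eigenvalue problem `T x = μ D (D x)`, the
eigenvalues `lam 0 ≤ lam 1 ≤ ⋯` being listed with multiplicity. The eigenvectors are `φ n`; it is
their images `ψ n = D (φ n)` that form a Hilbert basis. -/
structure IsPencilEigenbasis (T D : E →L[ℝ] E) (lam : ℕ → ℝ) (φ : ℕ → E)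
    (ψ : HilbertBasis ℕ ℝ E) : Prop where
  monotone : Monotone lam
  tendsto_atTop : Tendsto lam atTop atTop
  map_right (n : ℕ) : D (φ n) = ψ n
  map_left (n : ℕ) : T (φ n) = lam n • D (ψ n)

-- With `R = T⁻¹`, the vector `ψ = D φ` is an eigenvector of the compact operator `D R D`.
theorem exists_isPencilEigenbasis [CompleteSpace E] (hE : ¬ FiniteDimensional ℝ E)
    {T D : E →L[ℝ] E} (hT : T.IsPositive) (hTu : IsUnit T) (hD : D.IsSymmetric)
    (hDc : IsCompactOperator D) (hDi : Function.Injective D) :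
    ∃ lam φ ψ, IsPencilEigenbasis T D lam φ ψ := by
  obtain ⟨T, rfl⟩ := hTu
  set R : E →L[ℝ] E := ↑T⁻¹
  have hTR (x : E) : (T : E →L[ℝ] E) (R x) = x := DFunLike.congr_fun T.mul_inv x
  have hRpos : R.IsPositive := by
    refine (ContinuousLinearMap.isPositive_iff _).2 ⟨fun x y => ?_, fun x => ?_⟩
    · have := hT.isSymmetric (R x) (R y)
      simp only [ContinuousLinearMap.coe_coe, hTR] at this
      exact this.symm
    · simpa only [hTR] using hT.inner_nonneg_right (R x)
  have hRi : Function.Injective R := Function.LeftInverse.injective hTR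
  have hpos : (D ∘L R ∘L D).IsPositive := by
    refine (ContinuousLinearMap.isPositive_iff _).2 ⟨fun x y => ?_, fun x => ?_⟩
    · exact (hD _ _).trans ((hRpos.isSymmetric _ _).trans (hD _ _))
    · exact (hRpos.inner_nonneg_left (D x)).trans_eq (hD _ _).symm
  obtain ⟨ψ, c, hanti, hlim, hc⟩ := exists_antitone_hilbertBasis_eigenvectors hE
    (hDc.comp_clm (R ∘L D)) hpos (hDi.comp (hRi.comp hDi))
  refine ⟨fun n => (c n)⁻¹, fun n => (c n)⁻¹ • R (D (ψ n)), ψ,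
    fun m n hmn => inv_anti₀ (hc n).1 (hanti hmn), hlim.inv_tendsto_nhdsGT_zero, fun n => ?_,
    fun n => by rw [map_smul, hTR]⟩
  rw [map_smul, inv_smul_eq_iff₀ (hc n).1.ne']
  exact (hc n).2

namespace IsPencilEigenbasis

variable {T D : E →L[ℝ] E} {lam : ℕ → ℝ} {φ : ℕ → E} {ψ : HilbertBasis ℕ ℝ E}

theorem inner_map_left (h : IsPencilEigenbasis T D lam φ ψ) (hD : D.IsSymmetric) (n : ℕ) (x : E) :
    inner ℝ (T (φ n)) x = lam n * inner ℝ (ψ n) (D x) := by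
  rw [h.map_left, real_inner_smul_left]
  exact congrArg _ (hD _ _)

theorem finite_fiber (h : IsPencilEigenbasis T D lam φ ψ) (μ : ℝ) :
    Finite {k : ℕ // lam k = μ} := by
  obtain ⟨N, hN⟩ := eventually_atTop.1 (h.tendsto_atTop.eventually_gt_atTop μ)
  refine Set.Finite.to_subtype ((Set.finite_Iio N).subset fun k hk => ?_)
  exact Set.mem_Iio.2 (not_le.1 fun hNk => (hN k hNk).ne' hk)

theorem inner_eq_zero (h : IsPencilEigenbasis T D lam φ ψ) (hT : T.IsSymmetric)
    (hD : D.IsSymmetric) {μ : ℝ} {x : E} (hx : x ∈ pencilEigenspace T D μ) {n : ℕ}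
    (hn : lam n ≠ μ) : inner ℝ (ψ n) (D x) = 0 := by
  have heq : lam n * inner ℝ (ψ n) (D x) = μ * inner ℝ (ψ n) (D x) := calc
    _ = inner ℝ (φ n) (T x) := (h.inner_map_left hD n x).symm.trans (hT _ _)
    _ = μ * inner ℝ (φ n) (D (D x)) := by
      rw [mem_pencilEigenspace.1 hx, real_inner_smul_right]
    _ = μ * inner ℝ (ψ n) (D x) := by
      rw [← h.map_right]
      exact congrArg _ (hD _ _).symm
  exact (mul_eq_mul_right_iff.1 heq).resolve_left hn

theorem nonempty_basis (h : IsPencilEigenbasis T D lam φ ψ) (hT : T.IsSymmetric)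
    (hD : D.IsSymmetric) (hDi : Function.Injective D) (μ : ℝ) :
    Nonempty (Module.Basis {k : ℕ // lam k = μ} ℝ (pencilEigenspace T D μ)) := by
  have := h.finite_fiber μ
  have := Fintype.ofFinite {k : ℕ // lam k = μ}
  let v (k : {k : ℕ // lam k = μ}) : pencilEigenspace T D μ :=
    ⟨φ k, mem_pencilEigenspace.2 (by rw [h.map_left, h.map_right, k.2])⟩
  have hli : LinearIndependent ℝ v := by
    refine LinearIndependent.of_comp ((D : E →ₗ[ℝ] E) ∘ₗ Submodule.subtype _) ?_
    have hcomp : ((D : E →ₗ[ℝ] E) ∘ₗ Submodule.subtype _) ∘ v = fun k => ψ k.1 :=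
      funext fun k => h.map_right k.1
    rw [hcomp]
    exact ψ.orthonormal.linearIndependent.comp _ Subtype.val_injective
  refine ⟨Module.Basis.mk hli ?_⟩
  rintro ⟨x, hx⟩ -
  have hsum : x = ∑ k : {k : ℕ // lam k = μ}, inner ℝ (ψ k) (D x) • φ k := by
    refine hDi ?_
    have hrepr := ψ.hasSum_repr (D x)
    simp only [ψ.repr_apply_apply] at hrepr
    rw [map_sum]
    simp only [map_smul, h.map_right]
    refine hrepr.unique ((hasSum_subtype_iff_of_support_subset (s := {n | lam n = μ})
      fun n hn => ?_).1 (hasSum_fintype fun k : {k : ℕ // lam k = μ} => inner ℝ (ψ k) (D x) • ψ k))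
    by_contra hne
    exact hn (by simp only [h.inner_eq_zero hT hD hx hne, zero_smul])
  have hcoe : (⟨x, hx⟩ : pencilEigenspace T D μ) =
      ∑ k : {k : ℕ // lam k = μ}, inner ℝ (ψ k) (D x) • v k := Subtype.ext (by simpa [v] using hsum)
  rw [hcoe]
  exact Submodule.sum_mem _ fun k _ => Submodule.smul_mem _ _ (Submodule.subset_span ⟨k, rfl⟩)

-- Positivity of `T` on `x - ∑ j < M, ⟪ψ j, D x⟫ φ j`.
theorem sum_mul_inner_sq_le (h : IsPencilEigenbasis T D lam φ ψ) (hT : T.IsPositive)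
    (hD : D.IsSymmetric) (x : E) (M : ℕ) :
    ∑ j ∈ Finset.range M, lam j * inner ℝ (ψ j) (D x) ^ 2 ≤ inner ℝ (T x) x := by
  let y := ∑ j ∈ Finset.range M, inner ℝ (ψ j) (D x) • φ j
  have inner_Ty (z : E) : inner ℝ (T y) z =
      ∑ j ∈ Finset.range M, inner ℝ (ψ j) (D x) * (lam j * inner ℝ (ψ j) (D z)) := by
    simp only [y, map_sum, map_smul, sum_inner, real_inner_smul_left, h.inner_map_left hD]
  have inner_Dy {j : ℕ} (hj : j ∈ Finset.range M) :
      inner ℝ (ψ j) (D y) = inner ℝ (ψ j) (D x) := by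
    simp only [y, map_sum, map_smul, h.map_right]
    exact ψ.orthonormal.inner_right_sum _ hj
  have inner_Ty_x : inner ℝ (T y) x =
      ∑ j ∈ Finset.range M, lam j * inner ℝ (ψ j) (D x) ^ 2 :=
    (inner_Ty x).trans (Finset.sum_congr rfl fun j _ => by ring)
  have inner_Ty_y : inner ℝ (T y) y = inner ℝ (T y) x := by
    rw [inner_Ty, inner_Ty]
    exact Finset.sum_congr rfl fun j hj => by rw [inner_Dy hj]
  have inner_Tx_y : inner ℝ (T x) y = inner ℝ (T y) x :=
    (hT.isSymmetric x y).trans (real_inner_comm _ _)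
  have hnonneg := hT.inner_nonneg_left (x - y)
  rw [map_sub, inner_sub_left, inner_sub_right, inner_sub_right, inner_Tx_y, inner_Ty_y] at hnonneg
  linarith

end IsPencilEigenbasis

theorem sum_range_le_of_weights {lam p : ℕ → ℝ} (hlam : Monotone lam) (hp0 : ∀ j, 0 ≤ p j)
    (hp1 : ∀ j, p j ≤ 1) {n : ℕ} (hp : HasSum p n) {A : ℝ}
    (hA : ∀ M, ∑ j ∈ Finset.range M, lam j * p j ≤ A) :
    ∑ j ∈ Finset.range n, lam j ≤ A := by
  have hpartial (M : ℕ) (hM : n ≤ M) :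
      ∑ j ∈ Finset.range n, lam j + lam n * (∑ j ∈ Finset.range M, p j - n) ≤ A := by
    have hle : ∑ j ∈ Finset.range n, (lam j - lam n) ≤
        ∑ j ∈ Finset.range M, (lam j - lam n) * p j := calc
      _ ≤ ∑ j ∈ Finset.range n, (lam j - lam n) * p j := Finset.sum_le_sum fun j hj => by
        have := hlam (Finset.mem_range.1 hj).le
        nlinarith [hp1 j]
      _ ≤ _ := Finset.sum_le_sum_of_subset_of_nonneg (Finset.range_mono hM) fun j _ hj =>
        mul_nonneg (sub_nonneg.2 (hlam (not_lt.1 (mt Finset.mem_range.2 hj)))) (hp0 j)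
    simp only [sub_mul, Finset.sum_sub_distrib, Finset.sum_const, Finset.card_range, nsmul_eq_mul,
      ← Finset.mul_sum] at hle
    linarith [hA M]
  have hlim : Tendsto (fun M => ∑ j ∈ Finset.range n, lam j
      + lam n * (∑ j ∈ Finset.range M, p j - n)) atTop (𝓝 (∑ j ∈ Finset.range n, lam j)) := by
    simpa using ((hp.tendsto_sum_nat.sub_const (n : ℝ)).const_mul (lam n)).const_add _
  exact le_of_tendsto hlim (eventually_atTop.2 ⟨n, hpartial⟩)

-- The weights `∑ k < n, ⟪ψ j, D (b k)⟫²` lie in `[0, 1]` and add up to `n`.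
theorem IsPencilEigenbasis.sum_range_le {T D : E →L[ℝ] E} {lam : ℕ → ℝ} {φ : ℕ → E}
    {ψ : HilbertBasis ℕ ℝ E} (h : IsPencilEigenbasis T D lam φ ψ) (hT : T.IsPositive)
    (hD : D.IsSymmetric) {b : ℕ → E} (hb : Orthonormal ℝ fun k => D (b k)) (n : ℕ) :
    ∑ j ∈ Finset.range n, lam j ≤ ∑ k ∈ Finset.range n, inner ℝ (T (b k)) (b k) := by
  refine sum_range_le_of_weights
    (p := fun j => ∑ k ∈ Finset.range n, inner ℝ (ψ j) (D (b k)) ^ 2) h.monotone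
    (fun j => Finset.sum_nonneg fun k _ => sq_nonneg _) (fun j => ?_) ?_ (fun M => ?_)
  · have hbessel := hb.sum_inner_products_le (ψ j) (s := Finset.range n)
    rw [ψ.orthonormal.1] at hbessel
    simpa [real_inner_comm] using hbessel
  · have hparseval (k : ℕ) : HasSum (fun j => inner ℝ (ψ j) (D (b k)) ^ 2) 1 := by
      have := ψ.hasSum_inner_mul_inner (D (b k)) (D (b k))
      rw [real_inner_self_eq_norm_sq, hb.1] at this
      simpa [real_inner_comm, sq] using this
    simpa using hasSum_sum fun k (_ : k ∈ Finset.range n) => hparseval k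
  · simp_rw [Finset.mul_sum]
    rw [Finset.sum_comm]
    exact Finset.sum_le_sum fun k _ => h.sum_mul_inner_sq_le hT hD _ _

end HilbertSpace

theorem le_of_monotone_of_equiv_fiber {f g : ℕ → ℝ} (hf : Monotone f) (hg : Monotone g)
    (e : ∀ μ, {k : ℕ // f k = μ} ≃ {k : ℕ // g k = μ}) (n : ℕ) : g n ≤ f n := by
  let σ : ℕ ≃ ℕ := (Equiv.sigmaFiberEquiv f).symm.trans
    ((Equiv.sigmaCongrRight e).trans (Equiv.sigmaFiberEquiv g))
  have hσ (k : ℕ) : g (σ k) = f k := (e (f k) ⟨k, rfl⟩).2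
  obtain ⟨i, hi, hni⟩ : ∃ i ∈ Finset.range (n + 1), n ≤ σ i := by
    by_contra! hlt
    have := Finset.card_le_card_of_injOn σ (s := Finset.range (n + 1)) (t := Finset.range n)
      (fun i hi => Finset.mem_coe.2 (Finset.mem_range.2 (hlt i hi))) σ.injective.injOn
    simp at this
  calc g n ≤ g (σ i) := hg hni
    _ = f i := hσ i
    _ ≤ f n := hf (Nat.lt_succ_iff.1 (Finset.mem_range.1 hi))

theorem eq_of_monotone_of_mk_fiber_eq {f g : ℕ → ℝ} (hf : Monotone f) (hg : Monotone g)
    (h : ∀ μ, Cardinal.mk {k : ℕ // f k = μ} = Cardinal.mk {k : ℕ // g k = μ}) : f = g := by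
  have e (μ : ℝ) : {k : ℕ // f k = μ} ≃ {k : ℕ // g k = μ} := (Cardinal.eq.1 (h μ)).some
  exact funext fun n => le_antisymm (le_of_monotone_of_equiv_fiber hg hf (fun μ => (e μ).symm) n)
    (le_of_monotone_of_equiv_fiber hf hg e n)

/-! ### Diagonal operators on square-summable sequences -/

/-- The Hilbert space of real square-summable sequences. -/
abbrev SeqSpace : Type := lp (fun _ : ℕ => ℝ) 2

theorem memℓp_two_of_sum_sq_le {f : ℕ → ℝ} {C : ℝ}
    (h : ∀ n, ∑ k ∈ Finset.range n, f k ^ 2 ≤ C) : Memℓp f 2 :=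
  memℓp_gen (summable_of_sum_range_le (c := C) (fun _ => by positivity) (by simpa using h))

namespace SeqSpace

/-- The standard Hilbert basis of unit vectors. -/
def unit : HilbertBasis ℕ ℝ SeqSpace := .ofRepr (LinearIsometryEquiv.refl ℝ SeqSpace)

theorem inner_unit (k : ℕ) (a : SeqSpace) : inner ℝ (unit k) a = a k :=
  (unit.repr_apply_apply a k).symm

theorem unit_apply (j k : ℕ) : unit j k = if k = j then 1 else 0 := by
  rw [← inner_unit, orthonormal_iff_ite.1 unit.orthonormal]

theorem hasSum_inner (a b : SeqSpace) : HasSum (fun k => a k * b k) (inner ℝ a b) := by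
  simpa [mul_comm] using lp.hasSum_inner (𝕜 := ℝ) a b

theorem hasSum_sq (a : SeqSpace) : HasSum (fun k => a k ^ 2) (‖a‖ ^ 2) := by
  simpa only [sq, real_inner_self_eq_norm_mul_norm] using hasSum_inner a a

theorem norm_sq_le {a : SeqSpace} {C : ℝ} (h : ∀ n, ∑ k ∈ Finset.range n, a k ^ 2 ≤ C) :
    ‖a‖ ^ 2 ≤ C :=
  le_of_tendsto' (hasSum_sq a).tendsto_sum_nat h

theorem not_finiteDimensional : ¬ FiniteDimensional ℝ SeqSpace := fun _ =>
  have := unit.orthonormal.linearIndependent.finite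
  not_finite ℕ

theorem sum_mul_sq_le {c : ℕ → ℝ} {M : ℝ} (hc : ∀ k, |c k| ≤ M) (a : SeqSpace) (n : ℕ) :
    ∑ k ∈ Finset.range n, (c k * a k) ^ 2 ≤ M ^ 2 * ‖a‖ ^ 2 := calc
  _ ≤ ∑ k ∈ Finset.range n, M ^ 2 * a k ^ 2 := Finset.sum_le_sum fun k _ => by
    rw [mul_pow]
    exact mul_le_mul_of_nonneg_right (sq_le_sq' (abs_le.1 (hc k)).1 (abs_le.1 (hc k)).2)
      (sq_nonneg _)
  _ = M ^ 2 * ∑ k ∈ Finset.range n, a k ^ 2 := (Finset.mul_sum _ _ _).symm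
  _ ≤ M ^ 2 * ‖a‖ ^ 2 := mul_le_mul_of_nonneg_left
    (sum_le_hasSum _ (fun _ _ => sq_nonneg _) (hasSum_sq a)) (sq_nonneg M)

/-- Multiplication by a sequence `c` bounded by `M`, as an operator on `SeqSpace`. -/
def diagonal (c : ℕ → ℝ) {M : ℝ} (hc : ∀ k, |c k| ≤ M) : SeqSpace →L[ℝ] SeqSpace :=
  LinearMap.mkContinuous
    { toFun := fun a => ⟨fun k => c k * a k, memℓp_two_of_sum_sq_le (sum_mul_sq_le hc a)⟩
      map_add' := fun a b => by ext k; exact mul_add _ _ _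
      map_smul' := fun r a => by ext k; exact mul_left_comm _ _ _ } M fun a => by
    have hM : 0 ≤ M := (abs_nonneg _).trans (hc 0)
    refine le_of_sq_le_sq ?_ (by positivity)
    rw [mul_pow]
    exact norm_sq_le (sum_mul_sq_le hc a)

section Diagonal

variable {c : ℕ → ℝ} {M : ℝ} (hc : ∀ k, |c k| ≤ M)

theorem diagonal_apply (a : SeqSpace) (k : ℕ) : diagonal c hc a k = c k * a k := rfl

theorem norm_diagonal_le : ‖diagonal c hc‖ ≤ M :=
  LinearMap.mkContinuous_norm_le _ ((abs_nonneg _).trans (hc 0)) _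

theorem diagonal_isSymmetric : (diagonal c hc).IsSymmetric := fun a b => by
  refine (hasSum_inner (diagonal c hc a) b).unique
    ((hasSum_inner a (diagonal c hc b)).congr_fun fun k => ?_)
  rw [diagonal_apply, diagonal_apply]
  ring

theorem diagonal_injective (hc0 : ∀ k, c k ≠ 0) : Function.Injective (diagonal c hc) :=
  fun a b hab => by
    ext k
    exact mul_left_cancel₀ (hc0 k) (congrArg (fun x : SeqSpace => x k) hab)

theorem isCompactOperator_diagonal_of_eventually_zero {N : ℕ} (hN : ∀ k, N ≤ k → c k = 0) :
    IsCompactOperator (diagonal c hc) := by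
  have hsum : diagonal c hc = ∑ k ∈ Finset.range N,
      c k • (lp.singleContinuousLinearMap ℝ (fun _ : ℕ => ℝ) 2 k).comp
        (lp.evalCLM ℝ (fun _ : ℕ => ℝ) 2 k) := by
    ext a j
    have hterm (k : ℕ) : (c k • (lp.singleContinuousLinearMap ℝ (fun _ : ℕ => ℝ) 2 k).comp
        (lp.evalCLM ℝ (fun _ : ℕ => ℝ) 2 k)) a j = c k * (Pi.single k (a k) : ℕ → ℝ) j := rfl
    simp only [diagonal_apply, sum_apply, lp.coeFn_sum, Finset.sum_apply, hterm]
    rw [Finset.sum_eq_single j]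
    · rw [Pi.single_eq_same]
    · intro k _ hkj
      rw [Pi.single_eq_of_ne hkj.symm, mul_zero]
    · intro hj
      rw [hN j (by simpa using hj), zero_mul]
  rw [hsum]
  refine Submodule.sum_mem (compactOperator (RingHom.id ℝ) SeqSpace SeqSpace) fun k _ =>
    Submodule.smul_mem _ _ ?_
  have heval : IsCompactOperator (lp.evalCLM ℝ (fun _ : ℕ => ℝ) 2 k) :=
    isCompactOperator_of_locallyCompactSpace_dom _
  exact heval.clm_comp (lp.singleContinuousLinearMap ℝ (fun _ : ℕ => ℝ) 2 k)

theorem isCompactOperator_diagonal (hlim : Tendsto c atTop (𝓝 0)) :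
    IsCompactOperator (diagonal c hc) := by
  let trunc (N k : ℕ) : ℝ := if k < N then c k else 0
  have htrunc (N k : ℕ) : |trunc N k| ≤ M := by
    unfold trunc
    split_ifs
    exacts [hc k, by simpa using (abs_nonneg _).trans (hc 0)]
  refine isCompactOperator_of_tendsto (l := atTop) (F := fun N => diagonal (trunc N) (htrunc N))
    (Metric.tendsto_atTop.2 fun ε hε => ?_) (Eventually.of_forall fun N =>
      isCompactOperator_diagonal_of_eventually_zero _ fun k hk => if_neg (not_lt.2 hk))
  obtain ⟨N, hN⟩ := Metric.tendsto_atTop.1 hlim (ε / 2) (half_pos hε)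
  refine ⟨N, fun n hn => ?_⟩
  have htail (k : ℕ) : |trunc n k - c k| ≤ ε / 2 := by
    unfold trunc
    split_ifs with hk
    · simpa using (half_pos hε).le
    · simpa using (hN k (hn.trans (not_lt.1 hk))).le
  have hsub : diagonal (trunc n) (htrunc n) - diagonal c hc = diagonal _ htail := by
    ext a k
    exact (sub_mul _ _ _).symm
  rw [dist_eq_norm, hsub]
  exact (norm_diagonal_le htail).trans_lt (half_lt_self hε)

end Diagonal

end SeqSpace

/-! ### The oscillator in the Hermite basis -/

theorem harmonicEigenvalue_pos (k : ℕ) : 0 < harmonicEigenvalue k := by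
  unfold harmonicEigenvalue
  positivity

/-- The eigenvalues of `H^(-1/2)`, where `H = -d²/dx² + x²`. -/
def weight (k : ℕ) : ℝ := 1 / √(harmonicEigenvalue k)

theorem weight_pos (k : ℕ) : 0 < weight k :=
  one_div_pos.2 (Real.sqrt_pos.2 (harmonicEigenvalue_pos k))

theorem weight_sq (k : ℕ) : weight k ^ 2 = (harmonicEigenvalue k)⁻¹ := by
  rw [weight, div_pow, one_pow, Real.sq_sqrt (harmonicEigenvalue_pos k).le, one_div]

theorem weight_sq_mul_harmonicEigenvalue (k : ℕ) : weight k ^ 2 * harmonicEigenvalue k = 1 := by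
  rw [weight_sq, inv_mul_cancel₀ (harmonicEigenvalue_pos k).ne']

theorem abs_weight_le_one (k : ℕ) : |weight k| ≤ 1 := by
  rw [abs_of_pos (weight_pos k), weight]
  refine (div_le_one (Real.sqrt_pos.2 (harmonicEigenvalue_pos k))).2 (Real.one_le_sqrt.2 ?_)
  simp [harmonicEigenvalue]

theorem tendsto_weight : Tendsto weight atTop (𝓝 0) := by
  have hlim : Tendsto harmonicEigenvalue atTop atTop :=
    tendsto_atTop_add_const_right _ _ (tendsto_natCast_atTop_atTop.const_mul_atTop two_pos)
  exact (Real.tendsto_sqrt_atTop.comp hlim).inv_tendsto_atTop.congr fun k => (one_div _).symm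

/-- The operator `H^(-1/2)`, where `H = -d²/dx² + x²`, in the basis of Hermite functions. -/
def invSqrtOscillator : SeqSpace →L[ℝ] SeqSpace := SeqSpace.diagonal weight abs_weight_le_one

theorem invSqrtOscillator_apply (a : SeqSpace) (k : ℕ) : invSqrtOscillator a k = weight k * a k :=
  rfl

theorem invSqrtOscillator_isSymmetric : invSqrtOscillator.IsSymmetric :=
  SeqSpace.diagonal_isSymmetric _

theorem invSqrtOscillator_injective : Function.Injective invSqrtOscillator :=
  SeqSpace.diagonal_injective _ fun k => (weight_pos k).ne'

theorem isCompactOperator_invSqrtOscillator : IsCompactOperator invSqrtOscillator :=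
  SeqSpace.isCompactOperator_diagonal _ tendsto_weight

theorem sum_weight_mul_hermiteFn_sq_le (x : ℝ) (n : ℕ) :
    ∑ k ∈ Finset.range n, (weight k * hermiteFn k x) ^ 2 ≤ 5 := by
  simp only [mul_pow, weight_sq, inv_mul_eq_div]
  exact sum_hermiteFn_sq_div_le n x

/-- The vector `b ↦ (H^(-1/2) b)(x)`, where `H = -d²/dx² + x²`, in the basis of Hermite functions;
it represents the evaluation at `x` on the form domain of `H`. -/
def evalVec (x : ℝ) : SeqSpace :=
  ⟨fun k => weight k * hermiteFn k x, memℓp_two_of_sum_sq_le (sum_weight_mul_hermiteFn_sq_le x)⟩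

theorem evalVec_apply (x : ℝ) (k : ℕ) : evalVec x k = weight k * hermiteFn k x := rfl

theorem norm_evalVec_le (x : ℝ) : ‖evalVec x‖ ≤ 3 := by
  have hsq : ‖evalVec x‖ ^ 2 ≤ 5 := SeqSpace.norm_sq_le (sum_weight_mul_hermiteFn_sq_le x)
  nlinarith [norm_nonneg (evalVec x)]

theorem stronglyMeasurable_evalVec : StronglyMeasurable evalVec := by
  refine stronglyMeasurable_of_tendsto atTop
    (f := fun N x => ∑ k ∈ Finset.range N, evalVec x k • SeqSpace.unit k) (fun N => ?_)
    (tendsto_pi_nhds.2 fun x => (SeqSpace.unit.hasSum_repr (evalVec x)).tendsto_sum_nat)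
  simp only [evalVec_apply]
  exact Continuous.stronglyMeasurable (by fun_prop)

/-- The function `H^(-1/2) b = ∑ (2k + 1)^(-1/2) b k h_k`, where `H = -d²/dx² + x²`, with the `h_k`
the normalized Hermite functions. -/
def synth : SeqSpace →ₗ[ℝ] ℝ → ℝ := LinearMap.pi fun x => innerₛₗ ℝ (evalVec x)

theorem synth_apply (b : SeqSpace) (x : ℝ) : synth b x = inner ℝ (evalVec x) b := rfl

theorem abs_synth_le (b : SeqSpace) (x : ℝ) : |synth b x| ≤ 3 * ‖b‖ :=
  (abs_real_inner_le_norm _ _).trans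
    (mul_le_mul_of_nonneg_right (norm_evalVec_le x) (norm_nonneg b))

theorem hasSum_synth (b : SeqSpace) (x : ℝ) :
    HasSum (fun k => weight k * b k * hermiteFn k x) (synth b x) := by
  refine (SeqSpace.hasSum_inner (evalVec x) b).congr_fun fun k => ?_
  rw [evalVec_apply]
  ring

theorem synth_unit (k : ℕ) (x : ℝ) : synth (SeqSpace.unit k) x = weight k * hermiteFn k x := by
  rw [synth_apply, real_inner_comm, SeqSpace.inner_unit, evalVec_apply]

theorem continuous_synth (b : SeqSpace) : Continuous (synth b) := by
  let partialSum (N : ℕ) : SeqSpace := ∑ k ∈ Finset.range N, b k • SeqSpace.unit k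
  have hunif : TendstoUniformly (fun N => synth (partialSum N)) (synth b) atTop := by
    refine Metric.tendstoUniformly_iff.2 fun ε hε => ?_
    filter_upwards [Metric.tendsto_nhds.1 (SeqSpace.unit.hasSum_repr b).tendsto_sum_nat (ε / 3)
      (by positivity)] with N hN x
    change dist (partialSum N) b < ε / 3 at hN
    rw [dist_comm, dist_eq_norm] at hN
    rw [Real.dist_eq, ← Pi.sub_apply, ← map_sub]
    linarith [abs_synth_le (b - partialSum N) x]
  refine hunif.continuous (Frequently.of_forall fun N => ?_)
  have hpartial : synth (partialSum N) =
      fun x => ∑ k ∈ Finset.range N, b k * (weight k * hermiteFn k x) := by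
    ext x
    simp [partialSum, synth_unit]
  rw [hpartial]
  fun_prop

/-- The vector `H^(-1/2) f`, where `H = -d²/dx² + x²`, in the basis of Hermite functions, for an
integrable function `f`. -/
def coeffVec (f : ℝ → ℝ) : SeqSpace := ∫ x, f x • evalVec x

theorem integrable_smul_evalVec {f : ℝ → ℝ} (hf : Integrable f) :
    Integrable (fun x => f x • evalVec x) :=
  hf.smul_bdd 3 stronglyMeasurable_evalVec.aestronglyMeasurable
    (Eventually.of_forall norm_evalVec_le)

theorem inner_coeffVec {f : ℝ → ℝ} (hf : Integrable f) (a : SeqSpace) :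
    inner ℝ (coeffVec f) a = ∫ x, f x * synth a x := by
  rw [coeffVec, real_inner_comm, ← integral_inner (integrable_smul_evalVec hf)]
  simp only [inner_smul_right, synth_apply, real_inner_comm]

theorem coeffVec_apply {f : ℝ → ℝ} (hf : Integrable f) (k : ℕ) :
    coeffVec f k = weight k * ∫ x, f x * hermiteFn k x := by
  rw [← SeqSpace.inner_unit, real_inner_comm, inner_coeffVec hf, ← integral_const_mul]
  simp only [synth_unit, mul_left_comm]

theorem coeffVec_hermiteFn (k : ℕ) : coeffVec (hermiteFn k) = weight k • SeqSpace.unit k := by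
  ext j
  rw [coeffVec_apply (gaussianDecay_hermiteFn k).integrable, integral_hermiteFn_mul,
    lp.coeFn_smul, Pi.smul_apply, SeqSpace.unit_apply, smul_eq_mul]
  by_cases h : j = k
  · simp [h]
  · simp [h, Ne.symm h]

theorem integral_synth_mul_hermiteFn (b : SeqSpace) (k : ℕ) :
    ∫ x, synth b x * hermiteFn k x = weight k * b k := by
  have h := inner_coeffVec (gaussianDecay_hermiteFn k).integrable b
  rw [coeffVec_hermiteFn, real_inner_smul_left, SeqSpace.inner_unit] at h
  simp only [h, mul_comm]

theorem synth_injective : Function.Injective synth := by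
  refine (injective_iff_map_eq_zero synth).2 fun b hb => ?_
  ext k
  have h := integral_synth_mul_hermiteFn b k
  simp only [hb, Pi.zero_apply, zero_mul, integral_zero] at h
  exact (mul_eq_zero.1 h.symm).resolve_left (weight_pos k).ne'

theorem integrable_mul_synth {q : ℝ → ℝ} (hq : Integrable q) (b : SeqSpace) :
    Integrable (fun x => q x * synth b x) :=
  hq.mul_bdd (c := 3 * ‖b‖) (continuous_synth b).aestronglyMeasurable
    (Eventually.of_forall (abs_synth_le b))

/-- The operator `H^(-1/2) (H + q) H^(-1/2)`, where `H = -d²/dx² + x²`, in the basis of Hermite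
functions. -/
def perturbedForm (q : ℝ → ℝ) : SeqSpace →L[ℝ] SeqSpace :=
  1 + ∫ x, q x • InnerProductSpace.rankOne ℝ (evalVec x) (evalVec x)

section PerturbedForm

variable {q : ℝ → ℝ} (hq : Integrable q)

include hq

theorem perturbedForm_apply (a : SeqSpace) :
    perturbedForm q a = a + coeffVec fun x => q x * synth a x := by
  have hmeas : StronglyMeasurable fun x =>
      InnerProductSpace.rankOne ℝ (evalVec x) (evalVec x) :=
    ((InnerProductSpace.rankOne ℝ).continuous.clm_apply continuous_id).comp_stronglyMeasurable
      stronglyMeasurable_evalVec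
  have hint : Integrable fun x => q x • InnerProductSpace.rankOne ℝ (evalVec x) (evalVec x) := by
    refine hq.smul_bdd (3 * 3) hmeas.aestronglyMeasurable (Eventually.of_forall fun x => ?_)
    rw [InnerProductSpace.norm_rankOne]
    gcongr <;> exact norm_evalVec_le x
  rw [perturbedForm, add_apply, ContinuousLinearMap.integral_apply hint]
  simp only [smul_apply, InnerProductSpace.rankOne_apply, ← synth_apply,
    smul_smul, coeffVec, one_apply_eq_self]

theorem inner_perturbedForm (a b : SeqSpace) :
    inner ℝ (perturbedForm q a) b = inner ℝ a b + ∫ x, q x * (synth a x * synth b x) := by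
  rw [perturbedForm_apply hq, inner_add_left, inner_coeffVec (integrable_mul_synth hq a)]
  simp only [mul_assoc]

theorem inner_perturbedForm_self (a : SeqSpace) :
    inner ℝ (perturbedForm q a) a = ‖a‖ ^ 2 + ∫ x, q x * synth a x ^ 2 := by
  rw [inner_perturbedForm hq, real_inner_self_eq_norm_sq]
  simp only [sq]

theorem perturbedForm_isSymmetric : (perturbedForm q).IsSymmetric := fun a b => by
  change inner ℝ (perturbedForm q a) b = inner ℝ a (perturbedForm q b)
  rw [real_inner_comm (perturbedForm q b), inner_perturbedForm hq, inner_perturbedForm hq,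
    real_inner_comm]
  simp only [mul_comm (synth a _)]

theorem norm_sq_le_inner_perturbedForm (hq0 : ∀ᵐ x, 0 ≤ q x) (a : SeqSpace) :
    ‖a‖ ^ 2 ≤ inner ℝ (perturbedForm q a) a := by
  rw [inner_perturbedForm_self hq, le_add_iff_nonneg_right]
  exact integral_nonneg_of_ae (hq0.mono fun x hx => mul_nonneg hx (sq_nonneg _))

theorem perturbedForm_isPositive (hq0 : ∀ᵐ x, 0 ≤ q x) : (perturbedForm q).IsPositive :=
  (ContinuousLinearMap.isPositive_iff _).2 ⟨perturbedForm_isSymmetric hq,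
    fun a => (sq_nonneg _).trans (norm_sq_le_inner_perturbedForm hq hq0 a)⟩

theorem isUnit_perturbedForm (hq0 : ∀ᵐ x, 0 ≤ q x) : IsUnit (perturbedForm q) := by
  refine ContinuousLinearMap.isUnit_of_forall_le_norm_inner_map (𝕜 := ℝ) _ one_pos fun a => ?_
  rw [NNReal.coe_one, mul_one]
  exact (norm_sq_le_inner_perturbedForm hq hq0 a).trans (le_abs_self _)

theorem exists_isPencilEigenbasis_perturbedForm (hq0 : ∀ᵐ x, 0 ≤ q x) :
    ∃ lam φ ψ, IsPencilEigenbasis (perturbedForm q) invSqrtOscillator lam φ ψ :=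
  exists_isPencilEigenbasis SeqSpace.not_finiteDimensional (perturbedForm_isPositive hq hq0)
    (isUnit_perturbedForm hq hq0) invSqrtOscillator_isSymmetric
    isCompactOperator_invSqrtOscillator invSqrtOscillator_injective

-- The test vectors are those with `H^(-1/2) b k = h_k`.
theorem sum_le_sum_harmonicEigenvalue_add (hq0 : ∀ᵐ x, 0 ≤ q x) {lam : ℕ → ℝ} {φ : ℕ → SeqSpace}
    {ψ : HilbertBasis ℕ ℝ SeqSpace}
    (h : IsPencilEigenbasis (perturbedForm q) invSqrtOscillator lam φ ψ) (n : ℕ) :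
    ∑ k ∈ Finset.range n, lam k ≤
      ∑ k ∈ Finset.range n, (harmonicEigenvalue k + ∫ x, q x * hermiteFn k x ^ 2) := by
  let b (k : ℕ) : SeqSpace := (weight k)⁻¹ • SeqSpace.unit k
  have hDb (k : ℕ) : invSqrtOscillator (b k) = SeqSpace.unit k := by
    rw [map_smul, inv_smul_eq_iff₀ (weight_pos k).ne']
    ext j
    rw [invSqrtOscillator_apply, lp.coeFn_smul, Pi.smul_apply, SeqSpace.unit_apply, smul_eq_mul]
    split_ifs with hjk <;> simp [hjk]
  have hsynth (k : ℕ) (x : ℝ) : synth (b k) x = hermiteFn k x := by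
    rw [map_smul, Pi.smul_apply, synth_unit, smul_eq_mul, inv_mul_cancel_left₀ (weight_pos k).ne']
  have hnorm (k : ℕ) : ‖b k‖ ^ 2 = harmonicEigenvalue k := by
    rw [norm_smul, SeqSpace.unit.orthonormal.1, mul_one, norm_inv, inv_pow, Real.norm_eq_abs,
      sq_abs, weight_sq, inv_inv]
  calc ∑ k ∈ Finset.range n, lam k
      ≤ ∑ k ∈ Finset.range n, inner ℝ (perturbedForm q (b k)) (b k) :=
        h.sum_range_le (perturbedForm_isPositive hq hq0) invSqrtOscillator_isSymmetric
          (by simpa only [hDb] using SeqSpace.unit.orthonormal) n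
    _ = _ := by simp only [inner_perturbedForm_self hq, hsynth, hnorm]

end PerturbedForm

/-! ### Integration by parts and regularity of weak solutions -/

theorem continuous_of_absolutelyContinuous {f : ℝ → ℝ}
    (hf : ∀ a b, AbsolutelyContinuousOnInterval f a b) : Continuous f := by
  refine continuous_iff_continuousAt.2 fun x =>
    (hf (x - 1) (x + 1)).continuousOn.continuousAt ?_
  rw [Set.uIcc_of_le (by linarith)]
  exact Icc_mem_nhds (by linarith) (by linarith)

theorem absolutelyContinuous_of_continuous_deriv {f : ℝ → ℝ} (hf : Differentiable ℝ f)
    (hf' : Continuous (deriv f)) (a b : ℝ) : AbsolutelyContinuousOnInterval f a b :=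
  (contDiff_one_iff_deriv.2 ⟨hf, hf'⟩).contDiffOn.absolutelyContinuousOnInterval

/-- Functions that become integrable when damped by some `exp (-c |x|)`. The class contains both
`L¹` and the functions of at most exponential growth, hence the second derivatives of bounded
solutions. -/
def ExpIntegrable (g : ℝ → ℝ) : Prop :=
  ∃ c : ℝ, Integrable (fun x => Real.exp (-(c * |x|)) * g x)

namespace ExpIntegrable

variable {f g : ℝ → ℝ}

theorem of_integrable (hg : Integrable g) : ExpIntegrable g := ⟨0, by simpa using hg⟩

theorem of_expBounded (hg : AEStronglyMeasurable g) (hb : ExpBounded g) : ExpIntegrable g := by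
  obtain ⟨A, c, hA⟩ := hb
  refine ⟨c + 1, (integrable_exp_neg_abs.const_mul A).mono'
    (AEStronglyMeasurable.mul (by fun_prop) hg) (Eventually.of_forall fun x => ?_)⟩
  calc ‖Real.exp (-((c + 1) * |x|)) * g x‖ = Real.exp (-((c + 1) * |x|)) * |g x| := by
        rw [norm_mul, Real.norm_of_nonneg (Real.exp_pos _).le, Real.norm_eq_abs]
    _ ≤ Real.exp (-((c + 1) * |x|)) * (A * Real.exp (c * |x|)) := by gcongr; exact hA x
    _ = A * Real.exp (-|x|) := by rw [mul_left_comm, ← Real.exp_add]; ring_nf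

theorem congr_ae (hf : ExpIntegrable f) (hfg : f =ᵐ[volume] g) : ExpIntegrable g := by
  obtain ⟨c, hc⟩ := hf
  exact ⟨c, hc.congr (hfg.mono fun x hx => by simp only [hx])⟩

theorem exists_forall_ge (hg : ExpIntegrable g) :
    ∃ c : ℝ, ∀ d ≥ c, Integrable (fun x => Real.exp (-(d * |x|)) * g x) := by
  obtain ⟨c, hc⟩ := hg
  refine ⟨c, fun d hd => ?_⟩
  have hbdd (x : ℝ) : ‖Real.exp ((c - d) * |x|)‖ ≤ 1 := by
    rw [Real.norm_of_nonneg (Real.exp_pos _).le]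
    exact Real.exp_le_one_iff.2 (mul_nonpos_of_nonpos_of_nonneg (by linarith) (abs_nonneg x))
  refine (hc.bdd_mul (by fun_prop) (Eventually.of_forall hbdd)).congr
    (Eventually.of_forall fun x => ?_)
  simp only
  rw [← mul_assoc, ← Real.exp_add]
  ring_nf

theorem add (hf : ExpIntegrable f) (hg : ExpIntegrable g) :
    ExpIntegrable (fun x => f x + g x) := by
  obtain ⟨c, hc⟩ := hf.exists_forall_ge
  obtain ⟨d, hd⟩ := hg.exists_forall_ge
  refine ⟨max c d, ?_⟩
  simp only [mul_add]
  exact (hc _ (le_max_left c d)).add (hd _ (le_max_right c d))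

theorem intervalIntegrable (hg : ExpIntegrable g) (a b : ℝ) :
    IntervalIntegrable g volume a b := by
  obtain ⟨c, hc⟩ := hg
  have hexp : Continuous fun x : ℝ => Real.exp (c * |x|) := by fun_prop
  refine (hc.intervalIntegrable.continuousOn_mul hexp.continuousOn).congr fun x _ => ?_
  rw [← mul_assoc, ← Real.exp_add, add_neg_cancel, Real.exp_zero, one_mul]

end ExpIntegrable

theorem GaussianDecay.integrable_mul_of_expIntegrable {f r : ℝ → ℝ} (hf : GaussianDecay f)
    (hr : ExpIntegrable r) : Integrable (fun x => r x * f x) := by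
  obtain ⟨c, hc⟩ := hr
  obtain ⟨K, hK⟩ := hf.exists_abs_mul_le (m := fun x => Real.exp (c * |x|))
    ⟨1, c, fun x => by simp⟩ 0
  simp only [zero_mul, neg_zero, Real.exp_zero, mul_one] at hK
  have hmeas : AEStronglyMeasurable (fun x => Real.exp (c * |x|) * f x) volume :=
    AEStronglyMeasurable.mul (by fun_prop) hf.continuous.aestronglyMeasurable
  refine (hc.mul_bdd hmeas (Eventually.of_forall hK)).congr (Eventually.of_forall fun x => ?_)
  simp only
  rw [mul_mul_mul_comm, mul_left_comm, ← mul_assoc, mul_assoc, ← Real.exp_add]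
  simp [mul_comm]

theorem ExpBounded.of_expIntegrable_deriv {f : ℝ → ℝ}
    (hf : ∀ a b, AbsolutelyContinuousOnInterval f a b) (hf' : ExpIntegrable (deriv f)) :
    ExpBounded f := by
  obtain ⟨c, hc⟩ := hf'.exists_forall_ge
  have hdamped := (hc _ (le_max_left c 0)).abs
  set d := max c 0
  have hd : 0 ≤ d := le_max_right c 0
  have hsub (x : ℝ) : |f x - f 0| ≤
      Real.exp (d * |x|) * ∫ t, |Real.exp (-(d * |t|)) * deriv f t| := by
    calc |f x - f 0| = ‖∫ t in 0..x, deriv f t‖ := by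
          rw [(hf 0 x).integral_deriv_eq_sub, Real.norm_eq_abs]
      _ ≤ ∫ t in Set.uIoc 0 x, ‖deriv f t‖ :=
          intervalIntegral.norm_integral_le_integral_norm_uIoc
      _ ≤ ∫ t in Set.uIoc 0 x, Real.exp (d * |x|) * |Real.exp (-(d * |t|)) * deriv f t| := by
          refine setIntegral_mono_on (intervalIntegrable_iff.1 (hf'.intervalIntegrable 0 x)).norm
            (hdamped.const_mul _).integrableOn measurableSet_uIoc fun t ht => ?_
          have htx : |t| ≤ |x| := by
            simpa using Set.abs_sub_left_of_mem_uIcc (Set.uIoc_subset_uIcc ht)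
          rw [abs_mul, Real.abs_exp, ← mul_assoc, ← Real.exp_add, Real.norm_eq_abs]
          refine le_mul_of_one_le_left (abs_nonneg _) (Real.one_le_exp ?_)
          linarith [mul_le_mul_of_nonneg_left htx hd]
      _ ≤ ∫ t, Real.exp (d * |x|) * |Real.exp (-(d * |t|)) * deriv f t| :=
          setIntegral_le_integral (hdamped.const_mul _)
            (Eventually.of_forall fun t => by positivity)
      _ = _ := integral_const_mul _ _
  refine ⟨(∫ t, |Real.exp (-(d * |t|)) * deriv f t|) + |f 0|, d, fun x => ?_⟩
  have hone : 1 ≤ Real.exp (d * |x|) := Real.one_le_exp (by positivity)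
  calc |f x| ≤ |f x - f 0| + |f 0| := by simpa using abs_add_le (f x - f 0) (f 0)
    _ ≤ _ := by linarith [hsub x, mul_le_mul_of_nonneg_left hone (abs_nonneg (f 0))]

theorem integral_mul_deriv_eq_neg_integral_deriv_mul {f g : ℝ → ℝ}
    (hf : ∀ a b, AbsolutelyContinuousOnInterval f a b) (hf' : ExpIntegrable (deriv f))
    (hg : Differentiable ℝ g) (hgd : GaussianDecay g) (hg' : GaussianDecay (deriv g)) :
    ∫ x, f x * deriv g x = -∫ x, deriv f x * g x := by
  have hfb := ExpBounded.of_expIntegrable_deriv hf hf'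
  have hint : Integrable (fun x => deriv f x * g x) := hgd.integrable_mul_of_expIntegrable hf'
  have hint' : Integrable (fun x => f x * deriv g x) :=
    hg'.integrable_mul (continuous_of_absolutelyContinuous hf).aestronglyMeasurable hfb
  have hlim := intervalIntegral_tendsto_integral (hint.add hint') tendsto_neg_atTop_atBot
    (tendsto_id (α := ℝ))
  have hboundary (R : ℝ) : ∫ x in -R..R, (deriv f x * g x + f x * deriv g x)
      = f R * g R - f (-R) * g (-R) :=
    (hf _ _).integral_deriv_mul_eq_sub
      (absolutelyContinuous_of_continuous_deriv hg hg'.continuous _ _)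
  have hboundary_lim : Tendsto (fun R => f R * g R - f (-R) * g (-R)) atTop (𝓝 0) := by
    simpa using (hgd.tendsto_mul_atTop hfb).sub
      ((hgd.tendsto_mul_atBot hfb).comp tendsto_neg_atTop_atBot)
  have hzero : ∫ x, (deriv f x * g x + f x * deriv g x) = 0 :=
    tendsto_nhds_unique hlim (hboundary_lim.congr fun R => (hboundary R).symm)
  rw [integral_add hint hint'] at hzero
  linarith

/-- `u'' = g` in the sense of the eigenvalue equation: `u` is differentiable, `u'` is locally
absolutely continuous and the equation holds almost everywhere. -/
structure HasSecondDerivAE (u g : ℝ → ℝ) : Prop where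
  differentiable : Differentiable ℝ u
  absolutelyContinuous_deriv : ∀ a b, AbsolutelyContinuousOnInterval (deriv u) a b
  deriv_deriv_ae_eq : deriv (deriv u) =ᵐ[volume] g

namespace HasSecondDerivAE

variable {u g : ℝ → ℝ}

theorem continuous_deriv (h : HasSecondDerivAE u g) : Continuous (deriv u) :=
  continuous_of_absolutelyContinuous h.absolutelyContinuous_deriv

theorem absolutelyContinuous (h : HasSecondDerivAE u g) (a b : ℝ) :
    AbsolutelyContinuousOnInterval u a b :=
  absolutelyContinuous_of_continuous_deriv h.differentiable h.continuous_deriv a b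

theorem hasDerivAt_deriv (h : HasSecondDerivAE u g) : ∀ᵐ x, HasDerivAt (deriv u) (g x) x := by
  filter_upwards [ae_differentiableAt_of_ac h.absolutelyContinuous_deriv, h.deriv_deriv_ae_eq]
    with x hx hxg
  exact hxg ▸ hx.hasDerivAt

theorem expIntegrable_deriv (h : HasSecondDerivAE u g) (hg : ExpIntegrable g) :
    ExpIntegrable (deriv u) :=
  .of_expBounded h.continuous_deriv.aestronglyMeasurable
    (.of_expIntegrable_deriv h.absolutelyContinuous_deriv (hg.congr_ae h.deriv_deriv_ae_eq.symm))

theorem expBounded (h : HasSecondDerivAE u g) (hg : ExpIntegrable g) : ExpBounded u :=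
  .of_expIntegrable_deriv h.absolutelyContinuous (h.expIntegrable_deriv hg)

theorem integral_mul_deriv_deriv_hermiteFn (h : HasSecondDerivAE u g) (hg : ExpIntegrable g)
    (k : ℕ) : ∫ x, u x * deriv (deriv (hermiteFn k)) x = ∫ x, g x * hermiteFn k x := by
  rw [integral_mul_deriv_eq_neg_integral_deriv_mul h.absolutelyContinuous
      (h.expIntegrable_deriv hg) (differentiable_deriv_hermiteFn k)
      (gaussianDecay_deriv_hermiteFn k) (gaussianDecay_deriv_deriv_hermiteFn k),
    integral_mul_deriv_eq_neg_integral_deriv_mul h.absolutelyContinuous_deriv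
      (hg.congr_ae h.deriv_deriv_ae_eq.symm) (differentiable_hermiteFn k)
      (gaussianDecay_hermiteFn k) (gaussianDecay_deriv_hermiteFn k), neg_neg]
  exact integral_congr_ae (h.deriv_deriv_ae_eq.mono fun x hx => by simp only [hx])

theorem add_affine (h : HasSecondDerivAE u g) (c β : ℝ) :
    HasSecondDerivAE (fun x => u x + (c + β * x)) g := by
  have hderiv : deriv (fun x => u x + (c + β * x)) = fun x => deriv u x + β :=
    funext fun x => ((h.differentiable x).hasDerivAt.add
      (((hasDerivAt_id x).const_mul β).const_add c)).deriv.trans (by simp)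
  refine ⟨h.differentiable.add (by fun_prop), fun a b => ?_, ?_⟩
  · rw [hderiv]
    exact (h.absolutelyContinuous_deriv a b).fun_add
      (contDiff_const (c := β)).contDiffOn.absolutelyContinuousOnInterval
  · simpa only [hderiv, deriv_add_const'] using h.deriv_deriv_ae_eq

end HasSecondDerivAE

theorem two_mul_deriv_hermiteFn (k : ℕ) (x : ℝ) : 2 * deriv (hermiteFn k) x =
    ladder k * hermiteFn (k - 1) x - ladder (k + 1) * hermiteFn (k + 1) x := by
  linear_combination (hasDerivAt_hermiteFn k x).deriv + (hasDerivAt_hermiteFn' k x).deriv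

theorem two_mul_deriv_deriv_hermiteFn (k : ℕ) (x : ℝ) : 2 * deriv (deriv (hermiteFn k)) x =
    ladder k * deriv (hermiteFn (k - 1)) x - ladder (k + 1) * deriv (hermiteFn (k + 1)) x := by
  have hrec : (fun x => 2 * deriv (hermiteFn k) x) =
      fun x => ladder k * hermiteFn (k - 1) x - ladder (k + 1) * hermiteFn (k + 1) x :=
    funext (two_mul_deriv_hermiteFn k)
  have hderiv (j : ℕ) := (differentiable_hermiteFn j x).hasDerivAt
  rw [← (((hderiv (k - 1)).const_mul (ladder k)).sub
    ((hderiv (k + 1)).const_mul (ladder (k + 1)))).deriv]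
  exact ((congrArg (deriv · x) hrec).symm.trans (deriv_const_mul_field 2)).symm

theorem integral_mul_eq_zero_of_ladder {f : ℝ → ℝ} {e d : ℕ → ℝ → ℝ} (hf : Continuous f)
    (hb : ExpBounded f) (he : ∀ k, GaussianDecay (e k))
    (hed : ∀ k x, 2 * d k x = ladder k * e (k - 1) x - ladder (k + 1) * e (k + 1) x)
    (hd : ∀ k, ∫ x, f x * d k x = 0) (h0 : ∫ x, f x * e 0 x = 0) (k : ℕ) :
    ∫ x, f x * e k x = 0 := by
  have hint (c : ℝ) (k : ℕ) : Integrable (fun x => c * (f x * e k x)) :=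
    ((he k).integrable_mul hf.aestronglyMeasurable hb).const_mul c
  have hrec (k : ℕ) : ladder k * ∫ x, f x * e (k - 1) x
      = ladder (k + 1) * ∫ x, f x * e (k + 1) x := by
    rw [← sub_eq_zero, ← integral_const_mul, ← integral_const_mul,
      ← integral_sub (hint _ _) (hint _ _), ← mul_zero 2, ← hd k, ← integral_const_mul]
    refine integral_congr_ae (Eventually.of_forall fun x => ?_)
    linear_combination -f x * hed k x
  induction k using Nat.strong_induction_on with
  | _ k ih =>
    cases k with
    | zero => exact h0
    | succ m =>
      refine (mul_eq_zero.1 ?_).resolve_left (ladder_succ_pos m).ne'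
      rw [← hrec m, ih (m - 1) (by lia), mul_zero]

theorem integral_hermiteFn_zero_pos : 0 < ∫ x, hermiteFn 0 x := by
  refine integral_pos_of_integrable_nonneg_nonzero (x := 0) (continuous_hermiteFn 0)
    (gaussianDecay_hermiteFn 0).integrable (fun x => ?_) ?_
  · simp only [hermiteFn_zero, Pi.zero_apply]; positivity
  · rw [hermiteFn_zero]; positivity

theorem integral_deriv_eq_zero {g : ℝ → ℝ} (hg : Differentiable ℝ g) (hgd : GaussianDecay g)
    (hg' : GaussianDecay (deriv g)) : ∫ x, deriv g x = 0 :=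
  integral_eq_zero_of_hasDerivAt_of_integrable (fun x => (hg x).hasDerivAt) hg'.integrable
    hgd.integrable

theorem integral_id_mul_deriv {g : ℝ → ℝ} (hg : Differentiable ℝ g) (hgd : GaussianDecay g)
    (hg' : GaussianDecay (deriv g)) : ∫ x, x * deriv g x = -∫ x, g x := by
  have hone : ExpIntegrable (deriv fun x : ℝ => x) := by
    rw [deriv_id'']
    exact .of_expBounded aestronglyMeasurable_const (.of_abs_le fun _ => le_rfl)
  simpa using integral_mul_deriv_eq_neg_integral_deriv_mul (f := fun x => x)
    (absolutelyContinuous_of_continuous_deriv differentiable_id (by simp [continuous_const]))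
    hone hg hgd hg'

section WeakDerivatives

variable {z : ℝ → ℝ}

theorem GaussianDecay.integral_sub_const_mul {g m : ℝ → ℝ} (hg : GaussianDecay g)
    (hz : Continuous z) (hzb : ExpBounded z) (hm : Continuous m) (hmb : ExpBounded m) (c : ℝ) :
    ∫ x, (z x - c * m x) * g x = (∫ x, z x * g x) - c * ∫ x, m x * g x := by
  rw [← integral_const_mul, ← integral_sub (hg.integrable_mul hz.aestronglyMeasurable hzb)
    ((hg.integrable_mul hm.aestronglyMeasurable hmb).const_mul c)]
  simp only [sub_mul, mul_assoc]

theorem exists_eq_const_of_integral_mul_deriv_hermiteFn (hz : Continuous z) (hb : ExpBounded z)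
    (h : ∀ k, ∫ x, z x * deriv (hermiteFn k) x = 0) : ∃ c, ∀ x, z x = c := by
  set c := (∫ x, z x * hermiteFn 0 x) / ∫ x, hermiteFn 0 x with hc
  have hone : ExpBounded (fun _ => 1) := .of_abs_le fun _ => le_rfl
  have hsub {g : ℝ → ℝ} (hg : GaussianDecay g) :=
    hg.integral_sub_const_mul hz hb continuous_const hone c
  simp only [mul_one, one_mul] at hsub
  have hrest : (fun x => z x - c) = 0 := by
    have hcont : Continuous fun x => z x - c := hz.sub continuous_const
    have hexp : ExpBounded fun x => z x - c := by simpa using hb.sub (hone.const_mul c)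
    refine eq_zero_of_integral_mul_hermiteFn hcont hexp
      (integral_mul_eq_zero_of_ladder hcont hexp gaussianDecay_hermiteFn two_mul_deriv_hermiteFn
        (fun k => ?_) ?_)
    · rw [hsub (gaussianDecay_deriv_hermiteFn k), h, integral_deriv_eq_zero
        (differentiable_hermiteFn k) (gaussianDecay_hermiteFn k) (gaussianDecay_deriv_hermiteFn k),
        mul_zero, sub_zero]
    · rw [hsub (gaussianDecay_hermiteFn 0), hc,
        div_mul_cancel₀ _ integral_hermiteFn_zero_pos.ne', sub_self]
  exact ⟨c, fun x => sub_eq_zero.1 (congrFun hrest x)⟩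

theorem exists_eq_affine_of_integral_mul_deriv_deriv_hermiteFn (hz : Continuous z)
    (hb : ExpBounded z) (h : ∀ k, ∫ x, z x * deriv (deriv (hermiteFn k)) x = 0) :
    ∃ c β, ∀ x, z x = c + β * x := by
  set β := -(∫ x, z x * deriv (hermiteFn 0) x) / ∫ x, hermiteFn 0 x with hβ
  have hdecay := gaussianDecay_deriv_hermiteFn
  have hdecay' := gaussianDecay_deriv_deriv_hermiteFn
  have hsub {g : ℝ → ℝ} (hg : GaussianDecay g) :=
    hg.integral_sub_const_mul hz hb continuous_id' expBounded_id β
  have hcont : Continuous fun x => z x - β * x := hz.sub (continuous_const.mul continuous_id)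
  have hexp : ExpBounded fun x => z x - β * x := hb.sub (expBounded_id.const_mul β)
  have hzero (k : ℕ) : ∫ x, (z x - β * x) * deriv (deriv (hermiteFn k)) x = 0 := by
    rw [hsub (hdecay' k), h,
      integral_id_mul_deriv (differentiable_deriv_hermiteFn k) (hdecay k) (hdecay' k),
      integral_deriv_eq_zero (differentiable_hermiteFn k) (gaussianDecay_hermiteFn k) (hdecay k),
      neg_zero, mul_zero, sub_zero]
  have hzero₀ : ∫ x, (z x - β * x) * deriv (hermiteFn 0) x = 0 := by
    rw [hsub (hdecay 0), integral_id_mul_deriv (differentiable_hermiteFn 0)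
      (gaussianDecay_hermiteFn 0) (hdecay 0), hβ, neg_div, neg_mul_neg,
      div_mul_cancel₀ _ integral_hermiteFn_zero_pos.ne', sub_self]
  obtain ⟨c, hzc⟩ := exists_eq_const_of_integral_mul_deriv_hermiteFn hcont hexp
    (integral_mul_eq_zero_of_ladder hcont hexp hdecay two_mul_deriv_deriv_hermiteFn hzero hzero₀)
  exact ⟨c, β, fun x => sub_eq_iff_eq_add.1 (hzc x)⟩

end WeakDerivatives

theorem exists_absolutelyContinuous_deriv_ae_eq {g : ℝ → ℝ}
    (hg : ∀ a b, IntervalIntegrable g volume a b) :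
    ∃ v : ℝ → ℝ, (∀ a b, AbsolutelyContinuousOnInterval v a b) ∧ deriv v =ᵐ[volume] g := by
  have hcover (R : ℝ) {x : ℝ} (hx : |x| ≤ R) : x ∈ Set.uIcc (-R) R :=
    Set.Icc_subset_uIcc (abs_le.1 hx)
  refine ⟨fun x => ∫ t in (0 : ℝ)..x, g t, fun a b => ?_, ?_⟩
  · set R := max |a| |b|
    have hzero : (0 : ℝ) ∈ Set.uIcc (-R) R :=
      hcover R (abs_zero.trans_le ((abs_nonneg a).trans (le_max_left _ _)))
    exact ((hg (-R) R).absolutelyContinuousOnInterval_intervalIntegral hzero).mono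
      (Set.uIcc_subset_uIcc (hcover R (le_max_left _ _)) (hcover R (le_max_right _ _)))
  · have hball (n : ℕ) : ∀ᵐ x : ℝ, |x| ≤ n → deriv (fun x => ∫ t in (0 : ℝ)..x, g t) x = g x := by
      filter_upwards [(hg (-(n : ℝ)) n).ae_hasDerivAt_integral] with x hx hxn
      exact (hx (hcover n hxn) 0 (hcover n (by simp))).deriv
    filter_upwards [ae_all_iff.2 hball] with x hx
    obtain ⟨n, hn⟩ := exists_nat_ge |x|
    exact hx n hn

theorem exists_hasSecondDerivAE {g : ℝ → ℝ} (hg : ∀ a b, IntervalIntegrable g volume a b) :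
    ∃ w : ℝ → ℝ, HasSecondDerivAE w g := by
  obtain ⟨v, hv, hvg⟩ := exists_absolutelyContinuous_deriv_ae_eq hg
  have hderiv (x : ℝ) : HasDerivAt (fun x => ∫ t in (0 : ℝ)..x, v t) (v x) x :=
    ((continuous_of_absolutelyContinuous hv).integral_hasStrictDerivAt 0 x).hasDerivAt
  refine ⟨fun x => ∫ t in (0 : ℝ)..x, v t, fun x => (hderiv x).differentiableAt, ?_, ?_⟩ <;>
    rwa [funext fun x => (hderiv x).deriv]

-- If `w'' = g`, then `u - w` is orthogonal to all `h_k''`, hence affine.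
theorem hasSecondDerivAE_iff_forall_integral_mul_hermiteFn {u g : ℝ → ℝ} (hu : Continuous u)
    (hub : ExpBounded u) (hg : ExpIntegrable g) : HasSecondDerivAE u g ↔
      ∀ k, ∫ x, u x * deriv (deriv (hermiteFn k)) x = ∫ x, g x * hermiteFn k x := by
  refine ⟨fun h => h.integral_mul_deriv_deriv_hermiteFn hg, fun h => ?_⟩
  obtain ⟨w, hw⟩ := exists_hasSecondDerivAE hg.intervalIntegrable
  have hwc := hw.differentiable.continuous
  have hwb := hw.expBounded hg
  obtain ⟨c, β, hcβ⟩ := exists_eq_affine_of_integral_mul_deriv_deriv_hermiteFn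
    (hu.sub hwc) (hub.sub hwb) fun k => by
      have hk := gaussianDecay_deriv_deriv_hermiteFn k
      simp only [Pi.sub_apply, sub_mul]
      rw [integral_sub (hk.integrable_mul hu.aestronglyMeasurable hub)
        (hk.integrable_mul hwc.aestronglyMeasurable hwb), h,
        hw.integral_mul_deriv_deriv_hermiteFn hg, sub_self]
  rw [show u = fun x => w x + (c + β * x) from funext fun x => sub_eq_iff_eq_add'.1 (hcβ x)]
  exact hw.add_affine c β

/-! ### Square-integrable solutions are bounded -/

theorem antitoneOn_Ici_of_convexOn_of_integrableOn {f : ℝ → ℝ} {R : ℝ}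
    (hf : ConvexOn ℝ (Set.Ici R) f) (hi : IntegrableOn f (Set.Ici R)) :
    AntitoneOn f (Set.Ici R) := by
  intro a ha b hb hab
  by_contra! hlt
  have hab' : a < b := hab.lt_of_ne fun h => hlt.ne (congrArg f h)
  set m := (f b - f a) / (b - a)
  have hm : 0 < m := div_pos (sub_pos.2 hlt) (sub_pos.2 hab')
  have hgrowth (z : ℝ) (hz : b < z) : f b + m * (z - b) ≤ f z := by
    have hslope := hf.slope_mono_adjacent ha (Set.mem_Ici.2 (le_trans hb hz.le)) hab' hz
    rw [le_div_iff₀ (sub_pos.2 hz)] at hslope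
    linarith
  have hlim : Tendsto f atTop atTop :=
    tendsto_atTop_mono' atTop ((eventually_gt_atTop b).mono hgrowth)
      (tendsto_atTop_add_const_left _ _
        ((tendsto_atTop_add_const_right _ (-b) tendsto_id).const_mul_atTop hm))
  obtain ⟨z, hz⟩ := eventually_atTop.1
    ((hlim.eventually_ge_atTop 1).and (eventually_ge_atTop R))
  have hone : IntegrableOn (fun _ => (1 : ℝ)) (Set.Ici z) := by
    refine (hi.mono_set (Set.Ici_subset_Ici.2 (hz z le_rfl).2)).mono' (by fun_prop) ?_
    filter_upwards [ae_restrict_mem measurableSet_Ici] with x hx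
    simpa using (hz x hx).1
  simp [integrableOn_const_iff] at hone

theorem monotoneOn_Iic_of_convexOn_of_integrableOn {f : ℝ → ℝ} {R : ℝ}
    (hf : ConvexOn ℝ (Set.Iic R) f) (hi : IntegrableOn f (Set.Iic R)) :
    MonotoneOn f (Set.Iic R) := by
  have hpreimage : Neg.neg ⁻¹' Set.Iic R = Set.Ici (-R) := Set.neg_Iic R
  have hneg : AntitoneOn (f ∘ Neg.neg) (Set.Ici (-R)) := by
    refine antitoneOn_Ici_of_convexOn_of_integrableOn ?_ ?_ <;> rw [← hpreimage]
    · exact hf.comp_linearMap (-LinearMap.id)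
    · exact ((Measure.measurePreserving_neg volume).integrableOn_comp_preimage
        (Homeomorph.neg ℝ).measurableEmbedding).2 hi
  intro a ha b hb hab
  simpa using hneg (Set.mem_Ici.2 (neg_le_neg hb)) (Set.mem_Ici.2 (neg_le_neg ha))
    (neg_le_neg hab)

theorem exists_forall_le_of_convexOn_of_integrable {f : ℝ → ℝ} {R : ℝ} (hf : Continuous f)
    (hi : Integrable f) (hleft : ConvexOn ℝ (Set.Iic (-R)) f)
    (hright : ConvexOn ℝ (Set.Ici R) f) : ∃ C, ∀ x, f x ≤ C := by
  obtain ⟨C, hC⟩ := (isCompact_Icc (a := -|R|) (b := |R|)).bddAbove_image hf.continuousOn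
  have hle {x : ℝ} (hx : -|R| ≤ x) (hx' : x ≤ |R|) : f x ≤ C := hC ⟨x, ⟨hx, hx'⟩, rfl⟩
  have hR : -|R| ≤ |R| := neg_le_self (abs_nonneg R)
  refine ⟨C, fun x => ?_⟩
  rcases le_total |R| x with h | h
  · exact (antitoneOn_Ici_of_convexOn_of_integrableOn hright hi.integrableOn (le_abs_self R)
      ((le_abs_self R).trans h) h).trans (hle hR le_rfl)
  rcases le_total (-|R|) x with h' | h'
  · exact hle h' h
  · exact (monotoneOn_Iic_of_convexOn_of_integrableOn hleft hi.integrableOn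
      (h'.trans (neg_le_neg (le_abs_self R))) (neg_le_neg (le_abs_self R)) h').trans
      (hle le_rfl hR)

theorem HasSecondDerivAE.convexOn_sq {u V : ℝ → ℝ} (h : HasSecondDerivAE u fun x => V x * u x)
    {s : Set ℝ} (hs : Convex ℝ s) (hV : ∀ᵐ x, x ∈ s → 0 ≤ V x) :
    ConvexOn ℝ s fun x => u x ^ 2 := by
  have hderiv : deriv (fun x => u x ^ 2) = fun x => 2 * (u x * deriv u x) := by
    ext x
    simpa [mul_assoc] using ((h.differentiable x).hasDerivAt.fun_pow 2).deriv
  have hac (a b : ℝ) : AbsolutelyContinuousOnInterval (deriv fun x => u x ^ 2) a b := by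
    rw [hderiv]
    exact ((h.absolutelyContinuous a b).fun_mul (h.absolutelyContinuous_deriv a b)).const_mul 2
  have hnonneg : ∀ᵐ x, x ∈ s → 0 ≤ deriv (deriv fun x => u x ^ 2) x := by
    filter_upwards [h.hasDerivAt_deriv, hV] with x hx hVx hxs
    have hVx := hVx hxs
    rw [hderiv, (((h.differentiable x).hasDerivAt.fun_mul hx).const_mul 2).deriv]
    calc 0 ≤ 2 * (deriv u x ^ 2 + V x * u x ^ 2) := by positivity
      _ = _ := by ring
  refine MonotoneOn.convexOn_of_deriv hs (h.differentiable.continuous.pow 2).continuousOn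
    (h.differentiable.pow 2).differentiableOn fun x hx y hy hxy => ?_
  rw [← sub_nonneg, ← (hac x y).integral_deriv_eq_sub]
  refine intervalIntegral.integral_nonneg_of_ae_restrict hxy ?_
  filter_upwards [ae_restrict_of_ae hnonneg, ae_restrict_mem measurableSet_Icc] with t ht hxyt
  exact ht (hs.ordConnected.out (interior_subset hx) (interior_subset hy) hxyt)

section EigenvalueEquation

variable {q u : ℝ → ℝ} {μ : ℝ}

theorem isL2Solution_iff :
    IsL2Solution q μ u ↔ HasSecondDerivAE u (fun x => (x ^ 2 + q x - μ) * u x) ∧ MemLp u 2 := by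
  have hequation : (∀ᵐ x, -deriv (deriv u) x + (x ^ 2 + q x) * u x = μ * u x) ↔
      deriv (deriv u) =ᵐ[volume] fun x => (x ^ 2 + q x - μ) * u x :=
    eventually_congr (Eventually.of_forall fun x =>
      ⟨fun h => by linarith, fun h => by rw [h]; ring⟩)
  exact ⟨fun h => ⟨⟨h.differentiable, h.absolutelyContinuous_deriv, hequation.1 h.equation⟩,
    h.memLp⟩, fun h => ⟨h.1.differentiable, h.1.absolutelyContinuous_deriv,
    hequation.2 h.1.deriv_deriv_ae_eq, h.2⟩⟩

theorem IsL2Solution.exists_bound (hu : IsL2Solution q μ u) (hq0 : ∀ᵐ x, 0 ≤ q x) :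
    ∃ M, ∀ x, |u x| ≤ M := by
  obtain ⟨hu, hu2⟩ := isL2Solution_iff.1 hu
  have hconvex {s : Set ℝ} (hs : Convex ℝ s) (hμ : ∀ x ∈ s, √|μ| ≤ |x|) :
      ConvexOn ℝ s fun x => u x ^ 2 := by
    refine hu.convexOn_sq hs (hq0.mono fun x hqx hx => ?_)
    have hμx : |μ| ≤ x ^ 2 := by simpa using (Real.sqrt_le_iff.1 (hμ x hx)).2
    linarith [le_abs_self μ]
  obtain ⟨C, hC⟩ := exists_forall_le_of_convexOn_of_integrable
    (hu.differentiable.continuous.pow 2) hu2.integrable_sq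
    (hconvex (convex_Iic _) fun x hx => (le_neg_of_le_neg hx).trans (neg_le_abs x))
    (hconvex (convex_Ici _) fun x hx => le_trans hx (le_abs_self x))
  exact ⟨√C, fun x => Real.abs_le_sqrt (hC x)⟩

theorem expIntegrable_potential_mul (hq : Integrable q) (hu : Continuous u) {M : ℝ}
    (hM : ∀ x, |u x| ≤ M) : ExpIntegrable fun x => (x ^ 2 + q x - μ) * u x := by
  have hub : ExpBounded u := .of_abs_le hM
  have hpoly : ExpIntegrable fun x => (x * x - μ) * u x := by
    refine .of_expBounded (by fun_prop) (.mul (.sub (.mul expBounded_id expBounded_id) ?_) hub)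
    exact .of_abs_le fun _ => le_rfl
  have hqu : ExpIntegrable fun x => q x * u x :=
    .of_integrable (hq.mul_bdd hu.aestronglyMeasurable (Eventually.of_forall hM))
  exact (hpoly.add hqu).congr_ae (Eventually.of_forall fun x => by ring)

end EigenvalueEquation

/-! ### The eigenvalue equation in the basis of Hermite functions -/

theorem integrable_sum_hermiteFn_sq (c : ℕ → ℝ) (n : ℕ) :
    Integrable fun x => (∑ k ∈ Finset.range n, c k * hermiteFn k x) ^ 2 := by
  simp only [sq, Finset.sum_mul_sum, mul_mul_mul_comm (c _)]
  exact integrable_finsetSum _ fun j _ => integrable_finsetSum _ fun k _ =>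
    (integrable_hermiteFn_mul j k).const_mul _

theorem integral_sum_hermiteFn_sq (c : ℕ → ℝ) (n : ℕ) :
    ∫ x, (∑ k ∈ Finset.range n, c k * hermiteFn k x) ^ 2 = ∑ k ∈ Finset.range n, c k ^ 2 := by
  have hint (j k : ℕ) : Integrable fun x => c j * c k * (hermiteFn j x * hermiteFn k x) :=
    (integrable_hermiteFn_mul j k).const_mul _
  simp only [sq, Finset.sum_mul_sum, mul_mul_mul_comm (c _)]
  rw [integral_finsetSum _ fun j _ => integrable_finsetSum _ fun k _ => hint j k]
  refine Finset.sum_congr rfl fun j hj => ?_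
  rw [integral_finsetSum _ fun k _ => hint j k]
  simp only [integral_const_mul, integral_hermiteFn_mul, mul_ite, mul_one, mul_zero,
    Finset.sum_ite_eq, hj, if_true]

theorem memLp_synth (b : SeqSpace) : MemLp (synth b) 2 := by
  rw [memLp_two_iff_integrable_sq (continuous_synth b).aestronglyMeasurable]
  have hint := integrable_sum_hermiteFn_sq fun k => weight k * b k
  refine integrable_of_tendsto (Eventually.of_forall fun x =>
    ((hasSum_synth b x).tendsto_sum_nat.pow 2)) (fun n => (hint n).aestronglyMeasurable) ?_
  refine ne_top_of_le_ne_top (ENNReal.ofReal_ne_top (r := ‖b‖ ^ 2))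
    (liminf_le_of_frequently_le' (Frequently.of_forall fun n => ?_))
  rw [← ofReal_integral_norm_eq_lintegral_enorm (hint n)]
  refine ENNReal.ofReal_le_ofReal ?_
  calc ∫ x, ‖(∑ k ∈ Finset.range n, weight k * b k * hermiteFn k x) ^ 2‖
      = ∑ k ∈ Finset.range n, (weight k * b k) ^ 2 := by
        simp only [norm_pow, Real.norm_eq_abs, sq_abs, integral_sum_hermiteFn_sq]
    _ ≤ ∑ k ∈ Finset.range n, b k ^ 2 := Finset.sum_le_sum fun k _ => by
        rw [mul_pow]
        exact mul_le_of_le_one_left (sq_nonneg _) ((sq_le_one_iff_abs_le_one _).2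
          (abs_weight_le_one k))
    _ ≤ ‖b‖ ^ 2 := sum_le_hasSum _ (fun k _ => sq_nonneg _) b.hasSum_sq

theorem sum_sq_integral_mul_hermiteFn_le {u : ℝ → ℝ} (hu : MemLp u 2)
    (hi : ∀ k, Integrable fun x => u x * hermiteFn k x) (n : ℕ) :
    ∑ k ∈ Finset.range n, (∫ x, u x * hermiteFn k x) ^ 2 ≤ ∫ x, u x ^ 2 := by
  set c : ℕ → ℝ := fun k => ∫ x, u x * hermiteFn k x
  set s : ℝ → ℝ := fun x => ∑ k ∈ Finset.range n, c k * hermiteFn k x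
  have hmul (x : ℝ) : u x * s x = ∑ k ∈ Finset.range n, c k * (u x * hermiteFn k x) := by
    simp only [s, Finset.mul_sum, mul_left_comm]
  have hus : Integrable fun x => u x * s x := by
    simp only [hmul]
    exact integrable_finsetSum _ fun k _ => (hi k).const_mul _
  have hus_integral : ∫ x, u x * s x = ∑ k ∈ Finset.range n, c k ^ 2 := by
    simp only [hmul]
    rw [integral_finsetSum _ fun k _ => (hi k).const_mul _]
    simp only [integral_const_mul, sq, c]
  have hnonneg : 0 ≤ ∫ x, (u x ^ 2 - 2 * (u x * s x)) + s x ^ 2 :=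
    integral_nonneg fun x => (sq_nonneg (u x - s x)).trans_eq (by ring)
  rw [integral_add (hu.integrable_sq.sub' (hus.const_mul 2)) (integrable_sum_hermiteFn_sq c n),
    integral_sub hu.integrable_sq (hus.const_mul 2), integral_const_mul, hus_integral,
    integral_sum_hermiteFn_sq] at hnonneg
  linarith

section Correspondence

variable {q u : ℝ → ℝ} {μ : ℝ}

theorem hasSecondDerivAE_potential_iff (hq : Integrable q) (hu : Continuous u) {M : ℝ}
    (hM : ∀ x, |u x| ≤ M) : HasSecondDerivAE u (fun x => (x ^ 2 + q x - μ) * u x) ↔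
      ∀ k, harmonicEigenvalue k * (∫ x, u x * hermiteFn k x) + ∫ x, q x * u x * hermiteFn k x =
        μ * ∫ x, u x * hermiteFn k x := by
  have hpot : ExpIntegrable fun x => (x ^ 2 + q x - μ) * u x :=
    expIntegrable_potential_mul hq hu hM
  rw [hasSecondDerivAE_iff_forall_integral_mul_hermiteFn hu (.of_abs_le hM) hpot]
  refine forall_congr' fun k => ?_
  have hqu : Integrable fun x => q x * u x :=
    hq.mul_bdd hu.aestronglyMeasurable (Eventually.of_forall hM)
  have hk := gaussianDecay_hermiteFn k
  have huk := (hk.integrable_mul hu.aestronglyMeasurable (.of_abs_le hM)).const_mul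
    (harmonicEigenvalue k - μ)
  have hquk := hk.integrable_mul_of_expIntegrable (.of_integrable hqu)
  have hukk := (gaussianDecay_deriv_deriv_hermiteFn k).integrable_mul hu.aestronglyMeasurable
    (.of_abs_le hM)
  have hsplit : ∫ x, (x ^ 2 + q x - μ) * u x * hermiteFn k x =
      (∫ x, u x * deriv (deriv (hermiteFn k)) x) +
        ((harmonicEigenvalue k - μ) * (∫ x, u x * hermiteFn k x) +
          ∫ x, q x * u x * hermiteFn k x) := by
    rw [← integral_const_mul, ← integral_add huk hquk, ← integral_add hukk (huk.fun_add hquk)]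
    refine integral_congr_ae (Eventually.of_forall fun x => ?_)
    simp only [deriv_deriv_hermiteFn]
    ring
  rw [hsplit]
  constructor <;> intro h <;> linarith

theorem synth_mem_eigenspace_iff (hq : Integrable q) (b : SeqSpace) :
    synth b ∈ eigenspace q μ ↔ b ∈ pencilEigenspace (perturbedForm q) invSqrtOscillator μ := by
  have hmem : synth b ∈ eigenspace q μ ↔
      HasSecondDerivAE (synth b) fun x => (x ^ 2 + q x - μ) * synth b x :=
    isL2Solution_iff.trans (and_iff_left (memLp_synth b))
  rw [hmem, hasSecondDerivAE_potential_iff hq (continuous_synth b) (abs_synth_le b),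
    mem_pencilEigenspace, lp.ext_iff, funext_iff]
  refine forall_congr' fun k => ?_
  rw [perturbedForm_apply hq, lp.coeFn_add, Pi.add_apply, lp.coeFn_smul, Pi.smul_apply,
    coeffVec_apply (integrable_mul_synth hq b), invSqrtOscillator_apply, invSqrtOscillator_apply,
    integral_synth_mul_hermiteFn, smul_eq_mul]
  rw [← mul_right_inj' (weight_pos k).ne']
  constructor <;> intro h
  · linear_combination h - b k * weight_sq_mul_harmonicEigenvalue k
  · linear_combination h + b k * weight_sq_mul_harmonicEigenvalue k

-- With `a k = ∫ u h_k` and `c k = ∫ q u h_k` the equation says `H a = μ a - c`, so `b = H^(1/2) a`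
-- is the sequence `μ H^(-1/2) a - H^(-1/2) c`, which is square summable.
theorem IsL2Solution.exists_synth_eq (hu : IsL2Solution q μ u) (hq : Integrable q)
    (hq0 : ∀ᵐ x, 0 ≤ q x) : ∃ b, synth b = u := by
  obtain ⟨M, hM⟩ := hu.exists_bound hq0
  have huc := hu.differentiable.continuous
  have hint (k : ℕ) : Integrable fun x => u x * hermiteFn k x :=
    (gaussianDecay_hermiteFn k).integrable_mul huc.aestronglyMeasurable (.of_abs_le hM)
  have hqu : Integrable fun x => q x * u x :=
    hq.mul_bdd huc.aestronglyMeasurable (Eventually.of_forall hM)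
  have hweak := (hasSecondDerivAE_potential_iff hq huc hM).1 (isL2Solution_iff.1 hu).1
  let a : SeqSpace := ⟨fun k => ∫ x, u x * hermiteFn k x,
    memℓp_two_of_sum_sq_le (sum_sq_integral_mul_hermiteFn_le hu.memLp hint)⟩
  set b : SeqSpace := μ • invSqrtOscillator a - coeffVec fun x => q x * u x
  have hb (k : ℕ) : weight k * b k = ∫ x, u x * hermiteFn k x := by
    have hbk : b k = μ * (weight k * ∫ x, u x * hermiteFn k x) -
        weight k * ∫ x, q x * u x * hermiteFn k x := by
      rw [← coeffVec_apply hqu]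
      rfl
    rw [hbk]
    linear_combination (∫ x, u x * hermiteFn k x) * weight_sq_mul_harmonicEigenvalue k -
      weight k ^ 2 * hweak k
  have hsub : synth b - u = 0 := by
    refine eq_zero_of_integral_mul_hermiteFn ((continuous_synth b).sub huc)
      ((ExpBounded.of_abs_le (abs_synth_le b)).sub (.of_abs_le hM)) fun k => ?_
    simp only [Pi.sub_apply, sub_mul]
    rw [integral_sub ((gaussianDecay_hermiteFn k).integrable_mul
      (continuous_synth b).aestronglyMeasurable (.of_abs_le (abs_synth_le b))) (hint k),
      integral_synth_mul_hermiteFn, hb, sub_self]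
  exact ⟨b, sub_eq_zero.1 hsub⟩

theorem eigenspace_eq_map_synth (hq : Integrable q) (hq0 : ∀ᵐ x, 0 ≤ q x) :
    eigenspace q μ =
      (pencilEigenspace (perturbedForm q) invSqrtOscillator μ).map synth := by
  ext u
  constructor
  · intro hu
    obtain ⟨b, rfl⟩ := IsL2Solution.exists_synth_eq hu hq hq0
    exact ⟨b, (synth_mem_eigenspace_iff hq b).1 hu, rfl⟩
  · rintro ⟨b, hb, rfl⟩
    exact (synth_mem_eigenspace_iff hq b).2 hb

theorem IsPencilEigenbasis.isEigenvalueSequence {lam : ℕ → ℝ} {φ : ℕ → SeqSpace}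
    {ψ : HilbertBasis ℕ ℝ SeqSpace}
    (h : IsPencilEigenbasis (perturbedForm q) invSqrtOscillator lam φ ψ) (hq : Integrable q)
    (hq0 : ∀ᵐ x, 0 ≤ q x) : IsEigenvalueSequence q lam := by
  refine ⟨h.monotone, fun μ => ?_⟩
  obtain ⟨basis⟩ := h.nonempty_basis (perturbedForm_isSymmetric hq) invSqrtOscillator_isSymmetric
    invSqrtOscillator_injective μ
  rw [eigenspace_eq_map_synth hq hq0,
    ← (Submodule.equivMapOfInjective synth synth_injective _).rank_eq, basis.mk_eq_rank'']

theorem IsEigenvalueSequence.unique {lam lam' : ℕ → ℝ} (h : IsEigenvalueSequence q lam)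
    (h' : IsEigenvalueSequence q lam') : lam = lam' :=
  eq_of_monotone_of_mk_fiber_eq h.monotone h'.monotone fun μ =>
    (h.multiplicity μ).symm.trans (h'.multiplicity μ)

end Correspondence

/-! ### The trace inequality -/

theorem sum_integral_mul_hermiteFn_sq_le {q : ℝ → ℝ} (hq : Integrable q) (hq0 : ∀ᵐ x, 0 ≤ q x)
    (n : ℕ) : ∑ k ∈ Finset.range (n + 1), ∫ x, q x * hermiteFn k x ^ 2 ≤
      gammaTerm n / π * ∫ x, q x := by
  have hint (k : ℕ) : Integrable fun x => q x * hermiteFn k x ^ 2 := by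
    obtain ⟨C, hC⟩ := (gaussianDecay_hermiteFn k).exists_abs_le_const
    refine hq.mul_bdd (c := C ^ 2) ((continuous_hermiteFn k).pow 2).aestronglyMeasurable
      (Eventually.of_forall fun x => ?_)
    rw [norm_pow]
    exact pow_le_pow_left₀ (norm_nonneg _) (hC x) 2
  rw [← integral_finsetSum _ fun k _ => hint k, ← integral_const_mul]
  refine integral_mono_ae (integrable_finsetSum _ fun k _ => hint k) (hq.const_mul _) ?_
  filter_upwards [hq0] with x hx
  rw [← Finset.mul_sum, mul_comm]
  exact mul_le_mul_of_nonneg_right (christoffel_le n x) hx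

theorem sum_eigenvalue_shift_le_iff {q : ℝ → ℝ} {lam : ℕ → ℝ} {n : ℕ} :
    ∑ k ∈ Finset.range (n + 1),
        (lam k - harmonicEigenvalue k - 1 / (π * √(harmonicEigenvalue k)) * ∫ x, q x) ≤
      chi n / π * ∫ x, q x ↔
    ∑ k ∈ Finset.range (n + 1), lam k ≤
      ∑ k ∈ Finset.range (n + 1), harmonicEigenvalue k + gammaTerm n / π * ∫ x, q x := by
  rw [Finset.sum_sub_distrib, Finset.sum_sub_distrib, ← Finset.sum_mul, chi_eq, sub_div, sub_mul,
    Finset.sum_div]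
  simp only [mul_inv, div_eq_mul_inv, one_mul, mul_comm π⁻¹]
  constructor <;> intro h <;> linarith

end PerturbedOscillator

end

theorem theorem3p1 :
    (∀ q : ℝ → ℝ, Integrable q volume → (∀ᵐ x : ℝ, 0 ≤ q x) →
      (∃ lam : ℕ → ℝ, PerturbedOscillator.IsEigenvalueSequence q lam) ∧
      ∀ lam : ℕ → ℝ, PerturbedOscillator.IsEigenvalueSequence q lam → ∀ n : ℕ,
        ∑ k ∈ Finset.range (n + 1),
            (lam k - PerturbedOscillator.harmonicEigenvalue k
              - 1 / (Real.pi * √(PerturbedOscillator.harmonicEigenvalue k)) * ∫ x : ℝ, q x)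
          ≤ PerturbedOscillator.chi n / Real.pi * ∫ x : ℝ, q x) ∧
    (fun n : ℕ => (PerturbedOscillator.chi n : ℂ) - -PerturbedOscillator.spectralZeta (1 / 2))
      =O[atTop] (fun n : ℕ => 1 / √(n : ℝ)) := by
  refine ⟨fun q hq hq0 => ?_, PerturbedOscillator.isBigO_chi_add_spectralZeta⟩
  obtain ⟨lam, φ, ψ, hbasis⟩ :=
    PerturbedOscillator.exists_isPencilEigenbasis_perturbedForm hq hq0
  have hlam : PerturbedOscillator.IsEigenvalueSequence q lam :=
    hbasis.isEigenvalueSequence hq hq0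
  refine ⟨⟨lam, hlam⟩, fun lam' hlam' n => ?_⟩
  rw [hlam'.unique hlam, PerturbedOscillator.sum_eigenvalue_shift_le_iff]
  refine (PerturbedOscillator.sum_le_sum_harmonicEigenvalue_add hq hq0 hbasis (n + 1)).trans ?_
  rw [Finset.sum_add_distrib]
  gcongr
  exact PerturbedOscillator.sum_integral_mul_hermiteFn_sq_le hq hq0 n
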